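/- **Flag condition.** A metric space is a \emph{length space} if any two points $x,y$ are joined, for every $\varepsilon>0$, by a path of length less than $|x-y|+\varepsilon$. A \emph{spherical polyhedral space} is a length space $P$ that admits a finite triangulation such that every simplex is isometric, face by face, to a (nondegenerate) simplex in a unit sphere of the appropriate dimension; "triangulation of $P$" always means such a triangulation. It is \emph{all-right} if each of its simplices is isometric to a spherical simplex all of whose angles are right (for an edge this means that its length is $\tfrac{\pi}{2}$). A simplicial complex is \emph{flag} if any nonempty finite set of its vertices that are pairwise joined by edges spans a simplex. A metric space $X$ is \emph{$\mathrm{CAT}(1)$} if for all $p,q,x,y\in X$ such that the triples $p,x,y$ and $q,x,y$ both have perimeter less than $2\pi$, and for spherical model triangles $\tilde p\tilde x\tilde y$ and $\tilde q\tilde x\tilde y$ in the unit sphere $\mathbb{S}^2$ (triangles with the same side lengths as the triples) with common side $[\tilde x\tilde y]$, one has $$|p-q|_X\le|\tilde p-\tilde z|_{\mathbb{S}^2}+|\tilde z-\tilde q|_{\mathbb{S}^2}\qquad\text{for every }\tilde z\in[\tilde x\tilde y].$$ Let $P$ be a spherical polyhedral space and let $\tau$ be an all-right triangulation of $P$. Then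 $P$ is $\mathrm{CAT}(1)$ if and only if $\tau$ is a flag complex. -/

import Mathlib

open scoped BigOperators

/-- A length space: any two points `x`, `y` are joined, for every `ε > 0`, by a path of length
less than `dist x y + ε` (the length of a path is its total variation). -/
def IsLengthSpace (X : Type*) [MetricSpace X] : Prop :=
  ∀ (x y : X) (ε : ℝ), 0 < ε →
    ∃ γ : Path x y, eVariationOn (γ : unitInterval → X) Set.univ < ENNReal.ofReal (dist x y + ε)

/-- The intrinsic (angular) distance of the unit sphere, between two unit vectors. -/
noncomputable def sphDist {E : Type*} [NormedAddCommGroup E] [InnerProductSpace ℝ E]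
    (x y : E) : ℝ :=
  InnerProductGeometry.angle x y

/-- `a b c` are the vertices of a spherical model triangle, in the unit sphere of `ℝ³`, of the
points `p q r`: corresponding distances agree. -/
structure IsSphModelTriangle {X : Type*} [MetricSpace X] (p q r : X)
    (a b c : EuclideanSpace ℝ (Fin 3)) : Prop where
  norm_a : ‖a‖ = 1
  norm_b : ‖b‖ = 1
  norm_c : ‖c‖ = 1
  dist_ab : sphDist a b = dist p q
  dist_bc : sphDist b c = dist q r
  dist_ca : sphDist c a = dist r p

/-- The `CAT(1)` comparison for the quadruple `p, q, x, y`. It is void unless the model triangles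
of `p, x, y` and of `q, x, y` are both defined, that is, unless both perimeters are less
than `2π`. The points `z'` run through the side `[x' y']`, which is the
set of points of the sphere between `x'` and `y'`, as `dist x y < π`. -/
def CAT1Comparison {X : Type*} [MetricSpace X] (p q x y : X) : Prop :=
  dist p x + dist x y + dist y p < 2 * Real.pi →
  dist q x + dist x y + dist y q < 2 * Real.pi →
  ∀ p' q' x' y' : EuclideanSpace ℝ (Fin 3),
    IsSphModelTriangle p x y p' x' y' →
    IsSphModelTriangle q x y q' x' y' →
    ∀ z' : EuclideanSpace ℝ (Fin 3), ‖z'‖ = 1 →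
      sphDist x' z' + sphDist z' y' = sphDist x' y' →
      dist p q ≤ sphDist p' z' + sphDist z' q'

/-- A metric space is `CAT(1)` if all its quadruples of points satisfy `CAT(1)` comparison. -/
def IsCAT1 (X : Type*) [MetricSpace X] : Prop :=
  ∀ p q x y : X, CAT1Comparison p q x y

/-- A (nondegenerate) spherical simplex with vertices indexed by `σ`, in the unit sphere of the
Euclidean space of dimension `card σ`. -/
structure SphericalSimplex (σ : Type*) [Fintype σ] where
  vertex : σ → EuclideanSpace ℝ σ
  norm_vertex : ∀ i, ‖vertex i‖ = 1
  linearIndependent : LinearIndependent ℝ vertex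

namespace SphericalSimplex

variable {σ : Type*} [Fintype σ]

/-- The closed face of a spherical simplex spanned by the vertices in `t`: the points of the unit
sphere in the convex cone spanned by these vertices. -/
def face (S : SphericalSimplex σ) (t : Set σ) : Set (EuclideanSpace ℝ σ) :=
  {x | ‖x‖ = 1 ∧ ∃ c : σ → ℝ, (∀ i, 0 ≤ c i) ∧ (∀ i, i ∉ t → c i = 0) ∧
    x = ∑ i, c i • S.vertex i}

/-- The angle of a spherical simplex along its face of codimension `2` spanned by all the vertices
but the `i`-th and `j`-th, that is, the angle between the components of the vertices `i` and `j`
orthogonal to this face. For a triangle this is the angle at the third vertex. For a `1`-simplex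
the face is empty, and the angle is the length of the simplex. -/
noncomputable def dihedralAngle (S : SphericalSimplex σ) (i j : σ) : ℝ :=
  InnerProductGeometry.angle
    ((Submodule.span ℝ (S.vertex '' {k | k ≠ i ∧ k ≠ j}))ᗮ.starProjection (S.vertex i))
    ((Submodule.span ℝ (S.vertex '' {k | k ≠ i ∧ k ≠ j}))ᗮ.starProjection (S.vertex j))

/-- All the angles of the spherical simplex are right. -/
def IsAllRight (S : SphericalSimplex σ) : Prop :=
  ∀ i j, i ≠ j → S.dihedralAngle i j = Real.pi / 2

end SphericalSimplex

namespace AbstractSimplicialComplex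

variable {ι : Type*}

/-- The geometric realization of a simplicial complex with a finite vertex set, in barycentric
coordinates. -/
def Realization [Fintype ι] (K : AbstractSimplicialComplex ι) : Type _ :=
  {x : ι → ℝ // x ∈ stdSimplex ℝ ι ∧ ∃ s ∈ K, ∀ i, x i ≠ 0 → i ∈ s}

instance [Fintype ι] (K : AbstractSimplicialComplex ι) : TopologicalSpace K.Realization :=
  instTopologicalSpaceSubtype

/-- The closed simplex of the geometric realization spanned by a set of vertices. -/
def closedSimplex [Fintype ι] (K : AbstractSimplicialComplex ι) (s : Finset ι) :
    Set K.Realization :=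
  {x | ∀ i, x.1 i ≠ 0 → i ∈ s}

open Classical in
/-- A simplicial complex is flag if any finite nonempty set of vertices which are pairwise joined
by edges spans a simplex. -/
def IsFlag (K : AbstractSimplicialComplex ι) : Prop :=
  ∀ s : Finset ι, s.Nonempty → (∀ v ∈ s, ∀ w ∈ s, v ≠ w → {v, w} ∈ K) → s ∈ K

end AbstractSimplicialComplex

/-- A map `φ`, restricted to the image under `h` of the closed simplex `s` of `K`, is an isometry
onto the spherical simplex `S`, taking each face to the corresponding face. -/
structure IsSimplexIsometry {ι P : Type*} [Fintype ι] [MetricSpace P]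
    (K : AbstractSimplicialComplex ι) (h : K.Realization ≃ₜ P) (s : Finset ι)
    (S : SphericalSimplex s) (φ : P → EuclideanSpace ℝ s) : Prop where
  dist_eq : ∀ p ∈ h '' K.closedSimplex s, ∀ q ∈ h '' K.closedSimplex s,
    sphDist (φ p) (φ q) = dist p q
  image_face : ∀ t : Finset ι, t ⊆ s →
    φ '' (h '' K.closedSimplex t) = S.face {i | (i : ι) ∈ t}

/-- A finite triangulation of a metric space `P` with vertex set `ι`, such that every simplex (with
the metric of `P`) is isometric to a simplex in a unit sphere. -/
structure SphericalTriangulation (ι P : Type*) [Fintype ι] [MetricSpace P] where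
  complex : AbstractSimplicialComplex ι
  homeo : complex.Realization ≃ₜ P
  exists_isometry : ∀ s ∈ complex, ∃ (S : SphericalSimplex s) (φ : P → EuclideanSpace ℝ s),
    IsSimplexIsometry complex homeo s S φ

/-- The triangulation is all-right: every simplex is isometric to a spherical simplex all of whose
angles are right. -/
def SphericalTriangulation.IsAllRight {ι P : Type*} [Fintype ι] [MetricSpace P]
    (τ : SphericalTriangulation ι P) : Prop :=
  ∀ s ∈ τ.complex, ∃ (S : SphericalSimplex s) (φ : P → EuclideanSpace ℝ s),
    S.IsAllRight ∧ IsSimplexIsometry τ.complex τ.homeo s S φ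

/-- A spherical polyhedral space: a length space with a finite triangulation all of whose simplices
are isometric to simplices in unit spheres. -/
def IsSphericalPolyhedralSpace (P : Type*) [MetricSpace P] : Prop :=
  IsLengthSpace P ∧ ∃ n : ℕ, Nonempty (SphericalTriangulation (Fin n) P)

/-! Both directions use spherical coordinates. The vertices of an all-right simplex are orthonormal,
so the cosines of the distances to the vertices identify P with the set of nonnegative unit vectors
supported on simplices, and inside each simplex distance becomes angle
(`SphericalTriangulation.isSphericalCoords`).

Flag implies CAT(1). The Euclidean cone over P is a union of orthants, one for each simplex. If the
complex is flag, these are the orthants of the cliques of its edge graph, so the cone is the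
`OrthantSpace` of that graph (`dist_conePoint`). This space is CAT(0) by induction on the vertices
(`isCAT0On_face`): adding a vertex v attaches the closed star of v along the orthant space of its
link, and the star is the product of that space with a half-line. The gluing theorem
`IsCAT0On.union` is of Reshetnyak type, but all pieces carry the ambient metric and no angles
appear: first variation of a geodesic at its crossing point yields Stewart's inequality there
(`comparison_crossing`). Radial projection then turns the comparison for unit points of the cone
into the spherical one (`exists_thin_point`).

CAT(1) implies flag. A minimal missing simplex s has at least three vertices and all its proper
faces are present. For a vertex v of s, take q inside the opposite face, as the midpoint of points
x, y of that face with |vx| = |vy| = |xy| = π/2. Comparison gives |vq| ≤ π/2. But no simplex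
contains both v and the support of q, so a path from q must first leave a ball about q before it
enters the star of v, and from there it still needs π/2; hence |vq| > π/2 (`pi_div_two_lt_dist`). -/

/-! ### CAT(0) subsets for the ambient metric. -/

/-- A subset `A` of a metric space is `CAT(0)` for the ambient metric: any two points of `A` are
joined by a geodesic in `A`, whose points satisfy the comparison with all the points of `A`. -/
def IsCAT0On {X : Type*} [MetricSpace X] (A : Set X) : Prop :=
  ∀ x ∈ A, ∀ y ∈ A, ∀ t ∈ Set.Icc (0 : ℝ) 1, ∃ z ∈ A, ∀ p ∈ A,
    dist p z ^ 2 ≤ (1 - t) * dist p x ^ 2 + t * dist p y ^ 2 - t * (1 - t) * dist x y ^ 2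

namespace IsCAT0On

variable {X : Type*} [MetricSpace X] {A B C : Set X}

lemma dist_left_le {x y z : X} {t : ℝ} (ht : 0 ≤ t)
    (h : dist x z ^ 2 ≤ (1 - t) * dist x x ^ 2 + t * dist x y ^ 2 - t * (1 - t) * dist x y ^ 2) :
    dist x z ≤ t * dist x y := by
  rw [dist_self] at h
  refine abs_le_of_sq_le_sq' ?_ (by positivity) |>.2
  linarith

lemma dist_right_le {x y z : X} {t : ℝ} (ht : t ≤ 1)
    (h : dist y z ^ 2 ≤ (1 - t) * dist y x ^ 2 + t * dist y y ^ 2 - t * (1 - t) * dist x y ^ 2) :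
    dist z y ≤ (1 - t) * dist x y := by
  rw [dist_self, dist_comm y x, dist_comm y z] at h
  refine abs_le_of_sq_le_sq' ?_ (mul_nonneg (by linarith) dist_nonneg) |>.2
  linarith

/-- The comparison holds for every point dividing the distance in the given ratio. -/
lemma comparison (hA : IsCAT0On A) {x y z p : X} (hx : x ∈ A) (hy : y ∈ A) (hz : z ∈ A)
    (hp : p ∈ A) {t : ℝ} (ht : t ∈ Set.Icc (0 : ℝ) 1) (h1 : dist x z ≤ t * dist x y)
    (h2 : dist z y ≤ (1 - t) * dist x y) :
    dist p z ^ 2 ≤ (1 - t) * dist p x ^ 2 + t * dist p y ^ 2 - t * (1 - t) * dist x y ^ 2 := by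
  obtain ⟨w, -, h⟩ := hA x hx y hy t ht
  -- Uniqueness of geodesics: comparison for the point z itself gives |zw|² ≤ ((1 - t)t² + t(1 - t)²
  -- - t(1 - t))|xy|² = 0.
  have h0 := h z hz
  have : dist z w ^ 2 ≤ 0 := by
    have e1 : dist z x ^ 2 ≤ (t * dist x y) ^ 2 := by
      rw [dist_comm z x]; gcongr
    have e2 : dist z y ^ 2 ≤ ((1 - t) * dist x y) ^ 2 := by gcongr
    nlinarith [mul_le_mul_of_nonneg_left e1 (sub_nonneg.2 ht.2),
      mul_le_mul_of_nonneg_left e2 ht.1]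
  have hzw : z = w := by
    rw [← dist_eq_zero]
    exact pow_eq_zero_iff two_ne_zero |>.1 (le_antisymm this (sq_nonneg _))
  rw [hzw]
  exact h p hp

lemma exists_between (hA : IsCAT0On A) {x y : X} (hx : x ∈ A) (hy : y ∈ A) {t : ℝ}
    (ht : t ∈ Set.Icc (0 : ℝ) 1) :
    ∃ z ∈ A, dist x z ≤ t * dist x y ∧ dist z y ≤ (1 - t) * dist x y := by
  obtain ⟨z, hz, h⟩ := hA x hx y hy t ht
  exact ⟨z, hz, dist_left_le ht.1 (h x hx), dist_right_le ht.2 (h y hy)⟩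

/-- Comparison for two points on sides of a triangle issuing from the same vertex. -/
lemma comparison_corner (hA : IsCAT0On A) {o x y u w : X} (ho : o ∈ A) (hx : x ∈ A) (hy : y ∈ A)
    (hu : u ∈ A) (hw : w ∈ A) {s r : ℝ} (hs : s ∈ Set.Icc (0 : ℝ) 1) (hr : r ∈ Set.Icc (0 : ℝ) 1)
    (hu1 : dist o u ≤ s * dist o x) (hu2 : dist u x ≤ (1 - s) * dist o x)
    (hw1 : dist o w ≤ r * dist o y) (hw2 : dist w y ≤ (1 - r) * dist o y) :
    dist u w ^ 2 ≤ s ^ 2 * dist o x ^ 2 + r ^ 2 * dist o y ^ 2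
      - s * r * (dist o x ^ 2 + dist o y ^ 2 - dist x y ^ 2) := by
  have h1 := hA.comparison ho hy hw hu hr hw1 hw2
  have h2 := hA.comparison ho hx hu hy hs hu1 hu2
  have h3 : dist u o ^ 2 ≤ (s * dist o x) ^ 2 := by rw [dist_comm]; gcongr
  rw [dist_comm y u, dist_comm y o, dist_comm y x] at h2
  nlinarith [mul_le_mul_of_nonneg_left h3 (sub_nonneg.2 hr.2),
    mul_le_mul_of_nonneg_left h2 hr.1]

end IsCAT0On

/-! ### Gluing CAT(0) sets by first variation. -/

/-- For positive a and b the bound is minimal at σ = 1 + b / a, with value (a + b)². The shift by δ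
makes this choice available when a or b vanishes. -/
lemma le_add_sq_of_forall_one_lt {X a b : ℝ} (ha : 0 ≤ a) (hb : 0 ≤ b)
    (h : ∀ σ : ℝ, 1 < σ → X ≤ σ / (σ - 1) * b ^ 2 + σ * a ^ 2) : X ≤ (a + b) ^ 2 := by
  have key : ∀ δ : ℝ, 0 < δ → X ≤ (a + b + 2 * δ) ^ 2 := by
    intro δ hδ
    have ha' : 0 < a + δ := by linarith
    have hb' : 0 < b + δ := by linarith
    have h1 := h (1 + (b + δ) / (a + δ)) (by linarith [div_pos hb' ha'])
    have e1 : (1 + (b + δ) / (a + δ)) / (1 + (b + δ) / (a + δ) - 1) = (a + b + 2 * δ) / (b + δ) := by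
      rw [add_sub_cancel_left]; field_simp; ring
    have e2 : 1 + (b + δ) / (a + δ) = (a + b + 2 * δ) / (a + δ) := by field_simp; ring
    rw [e1, e2] at h1
    have h2 : (a + b + 2 * δ) / (b + δ) * b ^ 2 ≤ (a + b + 2 * δ) / (b + δ) * (b + δ) ^ 2 := by
      gcongr; linarith
    have h3 : (a + b + 2 * δ) / (a + δ) * a ^ 2 ≤ (a + b + 2 * δ) / (a + δ) * (a + δ) ^ 2 := by
      gcongr; linarith
    have e3 : (a + b + 2 * δ) / (b + δ) * (b + δ) ^ 2 = (a + b + 2 * δ) * (b + δ) := by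
      field_simp
    have e4 : (a + b + 2 * δ) / (a + δ) * (a + δ) ^ 2 = (a + b + 2 * δ) * (a + δ) := by
      field_simp
    nlinarith
  have hc : Filter.Tendsto (fun δ : ℝ => (a + b + 2 * δ) ^ 2) (nhdsWithin 0 (Set.Ioi 0))
      (nhds ((a + b + 2 * 0) ^ 2)) :=
    ((by fun_prop : Continuous fun δ : ℝ => (a + b + 2 * δ) ^ 2).tendsto 0).mono_left
      nhdsWithin_le_nhds
  have := ge_of_tendsto hc (Filter.eventually_of_mem self_mem_nhdsWithin key)
  simpa using this

/-- Extracts the first-order term of a variational inequality that has been divided by ε. -/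
lemma nonneg_of_forall_small {u v ε₀ : ℝ} (hε₀ : 0 < ε₀)
    (h : ∀ ε : ℝ, 0 < ε → ε ≤ ε₀ → 0 ≤ u + ε * v) : 0 ≤ u := by
  have hc : Filter.Tendsto (fun ε : ℝ => u + ε * v) (nhdsWithin 0 (Set.Ioi 0))
      (nhds (u + 0 * v)) :=
    ((by fun_prop : Continuous fun ε : ℝ => u + ε * v).tendsto 0).mono_left nhdsWithin_le_nhds
  have h1 : ∀ᶠ ε in nhdsWithin (0 : ℝ) (Set.Ioi 0), 0 ≤ u + ε * v := by
    filter_upwards [Ioc_mem_nhdsGT hε₀] with ε hε using h ε hε.1 hε.2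
  simpa using ge_of_tendsto hc h1

/-- Tangent bound, sharp at x = a. It replaces a distance by its square, which the comparisons
control, without loss to first order. -/
lemma le_sq_add_sq_div {x a : ℝ} (ha : 0 < a) : x ≤ (x ^ 2 + a ^ 2) / (2 * a) := by
  rw [le_div_iff₀ (by positivity)]
  nlinarith [sq_nonneg (x - a)]

namespace IsCAT0On

variable {X : Type*} [MetricSpace X] {A B C : Set X}

/-- The comparison at a point `c` where a geodesic from `p` to `z` crosses from `B` to `A`. -/
lemma comparison_crossing (hA : IsCAT0On A) (hB : IsCAT0On B) (hC : IsCAT0On C) (hCA : C ⊆ A)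
    (hCB : C ⊆ B) {p z w c c' : X} (hp : p ∈ B) (hz : z ∈ A) (hw : w ∈ A) (hc : c ∈ C)
    (hc' : c' ∈ C) (hpz : dist p z = dist p c + dist c z)
    (hpw : dist p w = dist p c' + dist c' w) :
    (dist p c + dist c z) * dist w c ^ 2 ≤ dist c z * dist w p ^ 2 + dist p c * dist w z ^ 2
      - dist p c * dist c z * (dist p c + dist c z) := by
  rcases (dist_nonneg (x := p) (y := c)).eq_or_lt with ha | ha
  · rw [← ha]
    have : p = c := dist_eq_zero.1 ha.symm
    rw [this]; simp
  rcases (dist_nonneg (x := c) (y := z)).eq_or_lt with hb | hb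
  · rw [← hb]
    have : c = z := dist_eq_zero.1 hb.symm
    rw [this]; simp
  rw [dist_comm w p, hpw, dist_comm w z, dist_comm w c]
  set a := dist p c
  set b := dist c z
  set e := dist c w
  set n := dist z w
  set a' := dist p c'
  set b' := dist c' w
  set m := dist c c' with hm
  -- In the flat model with p, c, z on a line, the left side is |pw|² by the law of cosines, the
  -- angles at c being supplementary.
  have key : a ^ 2 + e ^ 2 + (a / b) * (b ^ 2 + e ^ 2 - n ^ 2) ≤ (a' + b') ^ 2 := by
    apply le_add_sq_of_forall_one_lt dist_nonneg dist_nonneg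
    intro σ hσ
    have hσ0 : 0 < σ := by linarith
    have hμ : 0 < σ - 1 := by linarith
    -- The broken line p, u, y, z, with u at fraction σε of [cc'] and y at fraction ε of [cw],
    -- competes with the geodesic through c. V is the flat value of |uy|² / ε².
    set V := (1 - σ) * e ^ 2 + σ * b' ^ 2 + σ * (σ - 1) * m ^ 2 with hV
    have main : 0 ≤ σ * (a' ^ 2 - a ^ 2 - m ^ 2) / (2 * a) + (n ^ 2 - b ^ 2 - e ^ 2) / (2 * b)
        + (V / (a * (σ - 1)) + a * (σ - 1)) / 2 := by
      apply nonneg_of_forall_small (v := σ ^ 2 * m ^ 2 / (2 * a) + e ^ 2 / (2 * b))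
        (ε₀ := 1 / σ) (by positivity)
      intro ε hε hε1
      have hs : σ * ε ∈ Set.Icc (0 : ℝ) 1 :=
        ⟨by positivity, by rw [le_div_iff₀ hσ0] at hε1; linarith⟩
      have hr : ε ∈ Set.Icc (0 : ℝ) 1 := ⟨hε.le, by nlinarith [hs.2]⟩
      obtain ⟨u, hu, hu1, hu2⟩ := hC.exists_between hc hc' hs
      obtain ⟨y, hy, hy1, hy2⟩ := hA.exists_between (hCA hc) hw hr
      have i1 := hB.comparison (hCB hc) (hCB hc') (hCB hu) hp hs hu1 hu2
      have i2 := hA.comparison (hCA hc) hw hy hz hr hy1 hy2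
      have i3 := hA.comparison_corner (hCA hc) (hCA hc') hw (hCA hu) hy hs hr hu1 hu2 hy1 hy2
      have i4 : a + b ≤ dist p u + dist u y + dist z y := by
        rw [← hpz, dist_comm z y]; exact dist_triangle4 _ _ _ _
      have j1 := le_sq_add_sq_div (x := dist p u) ha
      have j2 := le_sq_add_sq_div (x := dist z y) hb
      -- In the flat model with the optimal σ = 1 + b' / a', the segment uy is parallel to pz and
      -- has length ε a (σ - 1). The tangent bound taken there is then sharp.
      have j3 := le_sq_add_sq_div (x := dist u y) (a := ε * (a * (σ - 1))) (by positivity)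
      have k1 : (dist p u ^ 2 + a ^ 2) / (2 * a) ≤
          a + ε * (σ * (a' ^ 2 - a ^ 2 - m ^ 2) / (2 * a)) + ε * (ε * (σ ^ 2 * m ^ 2 / (2 * a))) := by
        have : a + ε * (σ * (a' ^ 2 - a ^ 2 - m ^ 2) / (2 * a)) + ε * (ε * (σ ^ 2 * m ^ 2 / (2 * a)))
            = ((1 - σ * ε) * a ^ 2 + σ * ε * a' ^ 2 - σ * ε * (1 - σ * ε) * m ^ 2 + a ^ 2)
              / (2 * a) := by field_simp; ring
        rw [this]; gcongr
      have k2 : (dist z y ^ 2 + b ^ 2) / (2 * b) ≤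
          b + ε * ((n ^ 2 - b ^ 2 - e ^ 2) / (2 * b)) + ε * (ε * (e ^ 2 / (2 * b))) := by
        have : b + ε * ((n ^ 2 - b ^ 2 - e ^ 2) / (2 * b)) + ε * (ε * (e ^ 2 / (2 * b)))
            = ((1 - ε) * b ^ 2 + ε * n ^ 2 - ε * (1 - ε) * e ^ 2 + b ^ 2) / (2 * b) := by
          field_simp; ring
        rw [this]; gcongr
        rwa [dist_comm z c] at i2
      have k3 : (dist u y ^ 2 + (ε * (a * (σ - 1))) ^ 2) / (2 * (ε * (a * (σ - 1)))) ≤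
          ε * ((V / (a * (σ - 1)) + a * (σ - 1)) / 2) := by
        have : ε * ((V / (a * (σ - 1)) + a * (σ - 1)) / 2) =
            (ε ^ 2 * V + (ε * (a * (σ - 1))) ^ 2) / (2 * (ε * (a * (σ - 1)))) := by
          field_simp
        rw [this]; gcongr
        refine i3.trans (le_of_eq ?_)
        rw [hV]; ring
      have l : 0 ≤ ε * (σ * (a' ^ 2 - a ^ 2 - m ^ 2) / (2 * a) + (n ^ 2 - b ^ 2 - e ^ 2) / (2 * b)
        + (V / (a * (σ - 1)) + a * (σ - 1)) / 2 +
          ε * (σ ^ 2 * m ^ 2 / (2 * a) + e ^ 2 / (2 * b))) := by linarith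
      exact nonneg_of_mul_nonneg_right l hε
    have hmul := mul_nonneg (by positivity : 0 ≤ 2 * a) main
    have e1 : 2 * a * (σ * (a' ^ 2 - a ^ 2 - m ^ 2) / (2 * a) + (n ^ 2 - b ^ 2 - e ^ 2) / (2 * b)
        + (V / (a * (σ - 1)) + a * (σ - 1)) / 2) =
        (σ / (σ - 1) * b' ^ 2 + σ * a' ^ 2)
          - (a ^ 2 + e ^ 2 + (a / b) * (b ^ 2 + e ^ 2 - n ^ 2)) := by
      rw [hV]; field_simp; ring
    linarith
  have := mul_le_mul_of_nonneg_left key hb.le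
  have e2 : b * (a ^ 2 + e ^ 2 + (a / b) * (b ^ 2 + e ^ 2 - n ^ 2)) =
      b * (a ^ 2 + e ^ 2) + a * (b ^ 2 + e ^ 2 - n ^ 2) := by field_simp
  nlinarith

/-- `comparison_crossing` with respect to all points of the union. -/
lemma comparison_crossing_union (hA : IsCAT0On A) (hB : IsCAT0On B) (hC : IsCAT0On C)
    (hCA : C ⊆ A) (hCB : C ⊆ B)
    (hcross : ∀ p ∈ B, ∀ x ∈ A, ∃ c ∈ C, dist p x = dist p c + dist c x)
    {p z w c : X} (hp : p ∈ B) (hz : z ∈ A) (hw : w ∈ A ∪ B) (hc : c ∈ C)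
    (hpz : dist p z = dist p c + dist c z) :
    (dist p c + dist c z) * dist w c ^ 2 ≤ dist c z * dist w p ^ 2 + dist p c * dist w z ^ 2
      - dist p c * dist c z * (dist p c + dist c z) := by
  rcases hw with hw | hw
  · obtain ⟨c', hc', h'⟩ := hcross p hp w hw
    exact comparison_crossing hA hB hC hCA hCB hp hz hw hc hc' hpz h'
  · obtain ⟨c', hc', h'⟩ := hcross w hw z hz
    have := comparison_crossing hB hA hC hCB hCA hz hp hw hc hc' (p := z) (z := p)
      (by rw [dist_comm z p, hpz, dist_comm z c, dist_comm p c, add_comm])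
      (by rw [dist_comm z w, h', dist_comm z c', dist_comm w c', add_comm])
    rw [dist_comm z c, dist_comm c p] at this
    linarith

/-- Comparison for a side in `A` and a point of `B`, at a point outside the intersection. -/
lemma comparison_of_notMem (hA : IsCAT0On A) (hB : IsCAT0On B) (hC : IsCAT0On C)
    (hCA : C ⊆ A) (hCB : C ⊆ B)
    (hcross : ∀ p ∈ B, ∀ x ∈ A, ∃ c ∈ C, dist p x = dist p c + dist c x)
    {x y z p : X} (hx : x ∈ A) (hy : y ∈ A) (hz : z ∈ A) (hzC : z ∉ C) (hp : p ∈ B)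
    {t : ℝ} (ht : t ∈ Set.Icc (0 : ℝ) 1) (h1 : dist x z ≤ t * dist x y)
    (h2 : dist z y ≤ (1 - t) * dist x y) :
    dist p z ^ 2 ≤ (1 - t) * dist p x ^ 2 + t * dist p y ^ 2 - t * (1 - t) * dist x y ^ 2 := by
  obtain ⟨c, hc, hpz⟩ := hcross p hp z hz
  have hb : 0 < dist c z := by
    rw [dist_pos]; rintro rfl; exact hzC hc
  have kx := comparison_crossing_union hA hB hC hCA hCB hcross hp hz (Or.inl hx) hc hpz
  have ky := comparison_crossing_union hA hB hC hCA hCB hcross hp hz (Or.inl hy) hc hpz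
  have kc := hA.comparison hx hy hz (hCA hc) ht h1 h2
  have e1 : dist x z ^ 2 ≤ (t * dist x y) ^ 2 := by gcongr
  have e2 : dist y z ^ 2 ≤ ((1 - t) * dist x y) ^ 2 := by rw [dist_comm y z]; gcongr
  rw [hpz]
  rw [dist_comm x c, dist_comm x p] at kx
  rw [dist_comm y c, dist_comm y p] at ky
  have ha : 0 ≤ dist p c := dist_nonneg
  have ht0 := ht.1
  have ht1 := sub_nonneg.2 ht.2
  set a := dist p c
  set b := dist c z
  -- The inequalities at c for x and y are averaged with weights 1 - t and t, and comparison in A at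
  -- z eliminates |xc| and |yc|. A common factor |cz| remains, positive because z ∉ C.
  have m1 := mul_le_mul_of_nonneg_left kx ht1
  have m2 := mul_le_mul_of_nonneg_left ky ht0
  have m3 := mul_le_mul_of_nonneg_left kc (by positivity : 0 ≤ a + b)
  have m4 := mul_le_mul_of_nonneg_left e1 (mul_nonneg ha ht1)
  have m5 := mul_le_mul_of_nonneg_left e2 (mul_nonneg ha ht0)
  refine le_of_mul_le_mul_left ?_ hb
  nlinarith

/-- Comparison for a side in `A` and a point of `B`. -/
lemma comparison_union_left (hA : IsCAT0On A) (hB : IsCAT0On B) (hC : IsCAT0On C)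
    (hCA : C ⊆ A) (hCB : C ⊆ B)
    (hcross : ∀ p ∈ B, ∀ x ∈ A, ∃ c ∈ C, dist p x = dist p c + dist c x)
    (hface : ∀ x ∈ B, ∀ y ∈ B, ∀ z ∈ C, ∀ t ∈ Set.Ioo (0 : ℝ) 1, dist x z ≤ t * dist x y →
      dist z y ≤ (1 - t) * dist x y → x ∈ C ∧ y ∈ C)
    {x y z p : X} (hx : x ∈ A) (hy : y ∈ A) (hz : z ∈ A) (hp : p ∈ A ∪ B)
    {t : ℝ} (ht : t ∈ Set.Icc (0 : ℝ) 1) (h1 : dist x z ≤ t * dist x y)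
    (h2 : dist z y ≤ (1 - t) * dist x y) :
    dist p z ^ 2 ≤ (1 - t) * dist p x ^ 2 + t * dist p y ^ 2 - t * (1 - t) * dist x y ^ 2 := by
  rcases hp with hp | hp
  · exact hA.comparison hx hy hz hp ht h1 h2
  by_cases hzC : z ∉ C
  · exact comparison_of_notMem hA hB hC hCA hCB hcross hx hy hz hzC hp ht h1 h2
  push Not at hzC
  by_cases hpC : p ∈ C
  · exact hA.comparison hx hy hz (hCA hpC) ht h1 h2
  rcases ht.1.eq_or_lt with ht0 | ht0
  · rw [← ht0] at h1 ⊢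
    have : x = z := dist_eq_zero.1 (le_antisymm (by linarith) dist_nonneg)
    simp [this]
  rcases ht.2.eq_or_lt with ht1 | ht1
  · rw [ht1] at h2 ⊢
    have : z = y := dist_eq_zero.1 (le_antisymm (by linarith) dist_nonneg)
    simp [this]
  rcases (dist_nonneg (x := x) (y := y)).eq_or_lt with hn | hn
  · rw [← hn] at h1 h2 ⊢
    have e1 : x = z := dist_eq_zero.1 (le_antisymm (by linarith) dist_nonneg)
    have e2 : z = y := dist_eq_zero.1 (le_antisymm (by linarith) dist_nonneg)
    rw [e1, ← e2]; apply le_of_eq; ring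
  have ht1' : 0 < 1 - t := by linarith
  set n := dist x y with hndef
  have hcross' : ∀ p ∈ A, ∀ x ∈ B, ∃ c ∈ C, dist p x = dist p c + dist c x := by
    intro p hp x hx
    obtain ⟨c, hc, h⟩ := hcross x hx p hp
    exact ⟨c, hc, by rw [dist_comm p x, h, dist_comm p c, dist_comm x c, add_comm]⟩
  -- For z in C the crossing point may be z, and the previous argument has nothing to divide by.
  -- Instead z is moved by a fraction τ towards p to a point q ∉ C, where comparison on the side
  -- [zp] holds for x and for y. The triangle inequality |xy| ≤ |xq| + |qy|, read to first order in
  -- τ, gives the claim.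
  have key : 0 ≤ (1 - t) * dist p x ^ 2 + t * dist p y ^ 2 - t * (1 - t) * n ^ 2
      - dist p z ^ 2 := by
    apply nonneg_of_forall_small (v := dist p z ^ 2) one_pos
    intro τ hτ hτ1
    have hτI : τ ∈ Set.Icc (0 : ℝ) 1 := ⟨hτ.le, hτ1⟩
    obtain ⟨q, hq, hq1, hq2⟩ := hB.exists_between (hCB hzC) hp hτI
    have hqC : q ∉ C := by
      intro hqC
      rcases hτ1.eq_or_lt with h | h
      · rw [h] at hq2
        have : q = p := dist_eq_zero.1 (le_antisymm (by linarith) dist_nonneg)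
        exact hpC (this ▸ hqC)
      · exact hpC (hface z (hCB hzC) p hp q hqC τ ⟨hτ, h⟩ hq1 hq2).2
    have kx := comparison_of_notMem hB hA hC hCB hCA hcross' (hCB hzC) hp hq hqC hx hτI hq1 hq2
    have ky := comparison_of_notMem hB hA hC hCB hCA hcross' (hCB hzC) hp hq hqC hy hτI hq1 hq2
    have ex : dist x z ^ 2 ≤ (t * n) ^ 2 := by gcongr
    have ey : dist y z ^ 2 ≤ ((1 - t) * n) ^ 2 := by rw [dist_comm y z]; gcongr
    have jx := le_sq_add_sq_div (x := dist x q) (a := t * n) (by positivity)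
    have jy := le_sq_add_sq_div (x := dist y q) (a := (1 - t) * n) (by positivity)
    rw [dist_comm x p, dist_comm z p] at kx
    rw [dist_comm y p, dist_comm z p] at ky
    have tri : n ≤ dist x q + dist y q := by
      rw [dist_comm y q]; exact dist_triangle _ _ _
    rw [le_div_iff₀ (by positivity)] at jx jy
    have mx := mul_le_mul_of_nonneg_left ex (sub_nonneg.2 hτ1)
    have my := mul_le_mul_of_nonneg_left ey (sub_nonneg.2 hτ1)
    have m1 := mul_le_mul_of_nonneg_left (jx.trans (add_le_add_left (kx.trans
      (sub_le_sub_right (add_le_add_left mx _) _)) _)) ht1'.le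
    have m2 := mul_le_mul_of_nonneg_left (jy.trans (add_le_add_left (ky.trans
      (sub_le_sub_right (add_le_add_left my _) _)) _)) ht0.le
    have m3 := mul_le_mul_of_nonneg_left tri (by positivity : 0 ≤ 2 * t * (1 - t) * n)
    have : 0 ≤ τ * ((1 - t) * dist p x ^ 2 + t * dist p y ^ 2 - t * (1 - t) * n ^ 2
      - dist p z ^ 2 + τ * dist p z ^ 2) := by nlinarith
    exact nonneg_of_mul_nonneg_right this hτ
  linarith

/-- Comparison for a side in `B` and a point of `A`. -/
lemma comparison_union_right (hA : IsCAT0On A) (hB : IsCAT0On B) (hC : IsCAT0On C)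
    (hCA : C ⊆ A) (hCB : C ⊆ B)
    (hcross : ∀ p ∈ B, ∀ x ∈ A, ∃ c ∈ C, dist p x = dist p c + dist c x)
    (hface : ∀ x ∈ B, ∀ y ∈ B, ∀ z ∈ C, ∀ t ∈ Set.Ioo (0 : ℝ) 1, dist x z ≤ t * dist x y →
      dist z y ≤ (1 - t) * dist x y → x ∈ C ∧ y ∈ C)
    {x y z p : X} (hx : x ∈ B) (hy : y ∈ B) (hz : z ∈ B) (hp : p ∈ A ∪ B)
    {t : ℝ} (ht : t ∈ Set.Icc (0 : ℝ) 1) (h1 : dist x z ≤ t * dist x y)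
    (h2 : dist z y ≤ (1 - t) * dist x y) :
    dist p z ^ 2 ≤ (1 - t) * dist p x ^ 2 + t * dist p y ^ 2 - t * (1 - t) * dist x y ^ 2 := by
  rcases hp with hp | hp
  swap
  · exact hB.comparison hx hy hz hp ht h1 h2
  by_cases hzC : z ∉ C
  · refine comparison_of_notMem hB hA hC hCB hCA ?_ hx hy hz hzC hp ht h1 h2
    intro p hp x hx
    obtain ⟨c, hc, h⟩ := hcross x hx p hp
    exact ⟨c, hc, by rw [dist_comm p x, h, dist_comm p c, dist_comm x c, add_comm]⟩
  push Not at hzC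
  rcases ht.1.eq_or_lt with ht0 | ht0
  · rw [← ht0] at h1 ⊢
    have : x = z := dist_eq_zero.1 (le_antisymm (by linarith) dist_nonneg)
    simp [this]
  rcases ht.2.eq_or_lt with ht1 | ht1
  · rw [ht1] at h2 ⊢
    have : z = y := dist_eq_zero.1 (le_antisymm (by linarith) dist_nonneg)
    simp [this]
  obtain ⟨hxC, hyC⟩ := hface x hx y hy z hzC t ⟨ht0, ht1⟩ h1 h2
  exact hA.comparison (hCA hxC) (hCA hyC) (hCA hzC) hp ht h1 h2

/-- Here α = |xc| and β = |cy| for a point c of [xy], and X, Y, `c`, `z` are squared distances from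
a fixed point to x, to y, to c and to a point of [xc]. The comparison at c is substituted into the
one along [xc]; `htu` relates the two parameters of the last point. -/
lemma comparison_trans {α β t u X Y c z : ℝ} (hn : 0 < α + β) (hu : 0 ≤ u)
    (hc : (α + β) * c ≤ β * X + α * Y - α * β * (α + β))
    (hz : z ≤ (1 - u) * X + u * c - u * (1 - u) * α ^ 2) (htu : t * (α + β) = u * α) :
    z ≤ (1 - t) * X + t * Y - t * (1 - t) * (α + β) ^ 2 := by
  refine le_of_mul_le_mul_left ?_ hn
  have m1 := mul_le_mul_of_nonneg_left hc hu
  have m2 := mul_le_mul_of_nonneg_left hz hn.le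
  have e : (α + β) * ((1 - t) * X + t * Y - t * (1 - t) * (α + β) ^ 2) =
      ((α + β) - u * α) * X + u * α * Y - u * α * (α + β) * ((α + β) - u * α) := by
    rw [← htu]; ring
  rw [e]
  nlinarith

/-- Gluing of `CAT(0)` sets along a `CAT(0)` set that is met by geodesics joining them. -/
theorem union (hA : IsCAT0On A) (hB : IsCAT0On B) (hC : IsCAT0On C)
    (hCA : C ⊆ A) (hCB : C ⊆ B)
    (hcross : ∀ p ∈ B, ∀ x ∈ A, ∃ c ∈ C, dist p x = dist p c + dist c x)
    (hface : ∀ x ∈ B, ∀ y ∈ B, ∀ z ∈ C, ∀ t ∈ Set.Ioo (0 : ℝ) 1, dist x z ≤ t * dist x y →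
      dist z y ≤ (1 - t) * dist x y → x ∈ C ∧ y ∈ C) :
    IsCAT0On (A ∪ B) := by
  have mixed : ∀ x ∈ A, ∀ y ∈ B, ∀ t ∈ Set.Icc (0 : ℝ) 1, ∃ z ∈ A ∪ B, ∀ p ∈ A ∪ B,
      dist p z ^ 2 ≤ (1 - t) * dist p x ^ 2 + t * dist p y ^ 2 - t * (1 - t) * dist x y ^ 2 := by
    intro x hx y hy t ht
    obtain ⟨c, hc, hyx⟩ := hcross y hy x hx
    have hxy : dist x y = dist x c + dist c y := by
      rw [dist_comm x y, hyx, dist_comm y c, dist_comm c x, add_comm]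
    rcases (dist_nonneg (x := x) (y := y)).eq_or_lt with hn | hn
    · refine ⟨x, Or.inl hx, fun p _ => ?_⟩
      have : x = y := dist_eq_zero.1 hn.symm
      rw [← this, dist_self]; apply le_of_eq; ring
    have hcr : ∀ w ∈ A ∪ B, (dist x c + dist c y) * dist w c ^ 2 ≤
        dist c y * dist w x ^ 2 + dist x c * dist w y ^ 2
          - dist x c * dist c y * (dist x c + dist c y) := by
      intro w hw
      have := comparison_crossing_union hA hB hC hCA hCB hcross hy hx hw hc hyx
      rw [dist_comm y c, dist_comm c x] at this
      linarith
    have ha : 0 ≤ dist x c := dist_nonneg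
    have hb : 0 ≤ dist c y := dist_nonneg
    rw [hxy] at hn ⊢
    rcases le_total (t * (dist x c + dist c y)) (dist x c) with h | h
    · rcases ha.eq_or_lt with ha0 | ha0
      · have ht0 : t = 0 := by
          rw [← ha0] at h hn
          have := ht.1
          by_contra h0
          have : 0 < t := lt_of_le_of_ne this (Ne.symm h0)
          nlinarith
        exact ⟨x, Or.inl hx, fun p _ => by rw [ht0]; apply le_of_eq; ring⟩
      have hu : t * (dist x c + dist c y) / dist x c ∈ Set.Icc (0 : ℝ) 1 :=
        ⟨div_nonneg (mul_nonneg ht.1 hn.le) ha, by rw [div_le_one ha0]; exact h⟩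
      obtain ⟨z, hz, hz1, hz2⟩ := hA.exists_between hx (hCA hc) hu
      refine ⟨z, Or.inl hz, fun w hw => comparison_trans hn hu.1 (hcr w hw)
        (comparison_union_left hA hB hC hCA hCB hcross hface hx (hCA hc) hz hw hu hz1 hz2) ?_⟩
      field_simp
    · rcases hb.eq_or_lt with hb0 | hb0
      · have ht0 : t = 1 := by
          rw [← hb0] at h hn
          have := ht.2
          by_contra h0
          have : t < 1 := lt_of_le_of_ne this h0
          nlinarith
        exact ⟨y, Or.inr hy, fun p _ => by rw [ht0]; apply le_of_eq; ring⟩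
      have hu : (1 - t) * (dist y c + dist c x) / dist y c ∈ Set.Icc (0 : ℝ) 1 := by
        rw [dist_comm y c, dist_comm c x]
        exact ⟨div_nonneg (mul_nonneg (sub_nonneg.2 ht.2) (by linarith)) hb,
          by rw [div_le_one hb0]; linarith⟩
      obtain ⟨z, hz, hz1, hz2⟩ := hB.exists_between hy (hCB hc) hu
      refine ⟨z, Or.inr hz, fun w hw => ?_⟩
      have := comparison_trans (α := dist y c) (β := dist c x) (t := 1 - t)
        (X := dist w y ^ 2) (Y := dist w x ^ 2)
        (by rw [dist_comm y c, dist_comm c x]; linarith) hu.1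
        (by have := hcr w hw
            rw [dist_comm y c, dist_comm c x]; linarith)
        (comparison_union_right hA hB hC hCA hCB hcross hface hy (hCB hc) hz hw hu hz1 hz2)
        (by rw [div_mul_cancel₀]; rw [dist_comm]; exact hb0.ne')
      rw [dist_comm y c, dist_comm c x] at this
      linarith
  intro x hx y hy t ht
  rcases hx with hx | hx <;> rcases hy with hy | hy
  · obtain ⟨z, hz, h1, h2⟩ := hA.exists_between hx hy ht
    exact ⟨z, Or.inl hz, fun p hp =>
      comparison_union_left hA hB hC hCA hCB hcross hface hx hy hz hp ht h1 h2⟩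
  · exact mixed x hx y hy t ht
  · obtain ⟨z, hz, h⟩ := mixed y hy x hx (1 - t) ⟨by linarith [ht.2], by linarith [ht.1]⟩
    refine ⟨z, hz, fun p hp => ?_⟩
    have := h p hp
    rw [dist_comm y x] at this
    linarith
  · obtain ⟨z, hz, h1, h2⟩ := hB.exists_between hx hy ht
    exact ⟨z, Or.inr hz, fun p hp =>
      comparison_union_right hA hB hC hCA hCB hcross hface hx hy hz hp ht h1 h2⟩

end IsCAT0On

/-! ### The orthant space of a graph and its length metric. -/

/-- Two vectors with nonnegative coordinates lie in a common orthant of the orthant space of a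
graph: their supports lie in a common clique. -/
def OrthantCompat {ι : Type*} (G : SimpleGraph ι) (x y : EuclideanSpace ℝ ι) : Prop :=
  (∀ i, 0 ≤ x i) ∧ (∀ i, 0 ≤ y i) ∧
    ∀ i j, i ≠ j → (x i ≠ 0 ∨ y i ≠ 0) → (x j ≠ 0 ∨ y j ≠ 0) → G.Adj i j

/-- Broken lines of given length, all of whose edges lie in an orthant of the orthant space. -/
inductive OrthantChain {ι : Type*} [Fintype ι] (G : SimpleGraph ι) :
    EuclideanSpace ℝ ι → EuclideanSpace ℝ ι → ℝ → Prop
  | nil (x : EuclideanSpace ℝ ι) : OrthantCompat G x x → OrthantChain G x x 0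
  | cons (x y z : EuclideanSpace ℝ ι) (l : ℝ) : OrthantCompat G x y → OrthantChain G y z l →
      OrthantChain G x z (dist x y + l)

/-- The orthant space of a graph: the union of the orthants spanned by the cliques of the graph,
with its length metric. -/
def OrthantSpace {ι : Type*} (G : SimpleGraph ι) : Type _ :=
  {x : EuclideanSpace ℝ ι // OrthantCompat G x x}

section OrthantChain

variable {ι : Type*} {G : SimpleGraph ι} {x y z : EuclideanSpace ℝ ι} {l m : ℝ}

lemma OrthantCompat.symm (h : OrthantCompat G x y) : OrthantCompat G y x :=
  ⟨h.2.1, h.1, fun i j hij hi hj => h.2.2 i j hij hi.symm hj.symm⟩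

lemma OrthantCompat.left (h : OrthantCompat G x y) : OrthantCompat G x x :=
  ⟨h.1, h.1, fun i j hij hi hj => h.2.2 i j hij (by tauto) (by tauto)⟩

lemma OrthantCompat.right (h : OrthantCompat G x y) : OrthantCompat G y y := h.symm.left

lemma OrthantCompat.zero_right (h : OrthantCompat G x x) : OrthantCompat G x 0 :=
  ⟨h.1, fun i => le_rfl, fun i j hij hi hj => h.2.2 i j hij (by simpa using hi) (by simpa using hj)⟩

lemma OrthantCompat.of_subset (hx : ∀ i, 0 ≤ x i) (hy : OrthantCompat G y y)
    (h : ∀ i, x i ≠ 0 → y i ≠ 0) : OrthantCompat G x y :=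
  ⟨hx, hy.1, fun i j hij hi hj => hy.2.2 i j hij (by have := h i; tauto) (by have := h j; tauto)⟩

variable [Fintype ι]

lemma OrthantChain.left (h : OrthantChain G x y l) : OrthantCompat G x x := by
  cases h with
  | nil _ h => exact h
  | cons _ _ _ _ h _ => exact h.left

lemma OrthantChain.right (h : OrthantChain G x y l) : OrthantCompat G y y := by
  induction h with
  | nil _ h => exact h
  | cons _ _ _ _ _ _ ih => exact ih

lemma OrthantChain.single (h : OrthantCompat G x y) : OrthantChain G x y (dist x y) := by
  simpa using OrthantChain.cons x y y 0 h (.nil y h.right)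

lemma OrthantChain.trans (h : OrthantChain G x y l) (h' : OrthantChain G y z m) :
    OrthantChain G x z (l + m) := by
  induction h with
  | nil => simpa using h'
  | cons x y _ l hxy _ ih => rw [add_assoc]; exact .cons _ _ _ _ hxy (ih h')

lemma OrthantChain.symm (h : OrthantChain G x y l) : OrthantChain G y x l := by
  induction h with
  | nil x h => exact .nil x h
  | cons x y _ l hxy _ ih => rw [add_comm, dist_comm]; exact ih.trans (.single hxy.symm)

lemma OrthantChain.dist_le (h : OrthantChain G x y l) : dist x y ≤ l := by
  induction h with
  | nil x h => simp
  | cons x y z l hxy _ ih => exact (dist_triangle x y z).trans (by linarith)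

lemma exists_orthantChain (hx : OrthantCompat G x x) (hy : OrthantCompat G y y) :
    OrthantChain G x y (dist x 0 + dist 0 y) :=
  (OrthantChain.single hx.zero_right).trans (.single hy.zero_right.symm)

end OrthantChain

namespace OrthantSpace

variable {ι : Type*} [Fintype ι] {G : SimpleGraph ι}

noncomputable instance : Dist (OrthantSpace G) :=
  ⟨fun x y => sInf {l | OrthantChain G x.1 y.1 l}⟩

lemma dist_def (x y : OrthantSpace G) : dist x y = sInf {l | OrthantChain G x.1 y.1 l} := rfl

lemma dist_le_of_chain {x y : OrthantSpace G} {l : ℝ} (h : OrthantChain G x.1 y.1 l) :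
    dist x y ≤ l :=
  csInf_le ⟨dist x.1 y.1, fun _ h => h.dist_le⟩ h

lemma le_dist {x y : OrthantSpace G} {b : ℝ} (h : ∀ l, OrthantChain G x.1 y.1 l → b ≤ l) :
    b ≤ dist x y :=
  le_csInf ⟨_, exists_orthantChain x.2 y.2⟩ h

lemma exists_chain_lt {x y : OrthantSpace G} {b : ℝ} (h : dist x y < b) :
    ∃ l < b, OrthantChain G x.1 y.1 l := by
  obtain ⟨l, hl, h⟩ := exists_lt_of_csInf_lt ⟨_, exists_orthantChain x.2 y.2⟩ h
  exact ⟨l, h, hl⟩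

lemma dist_coe_le (x y : OrthantSpace G) : dist x.1 y.1 ≤ dist x y :=
  le_dist fun _ h => h.dist_le

noncomputable instance : MetricSpace (OrthantSpace G) where
  dist_self x := le_antisymm (dist_le_of_chain (.nil _ x.2))
    (dist_nonneg.trans (dist_coe_le x x))
  dist_comm x y := by
    rw [dist_def, dist_def]
    congr 1
    ext l
    exact ⟨fun h => h.symm, fun h => h.symm⟩
  dist_triangle x y z := by
    refine le_of_forall_pos_le_add fun ε hε => ?_
    obtain ⟨l, hl, h⟩ := exists_chain_lt (lt_add_of_pos_right (dist x y) (half_pos hε))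
    obtain ⟨m, hm, h'⟩ := exists_chain_lt (lt_add_of_pos_right (dist y z) (half_pos hε))
    linarith [dist_le_of_chain (h.trans h')]
  eq_of_dist_eq_zero {x y} h := by
    apply Subtype.ext
    exact dist_le_zero.1 ((dist_coe_le x y).trans h.le)

lemma dist_eq_of_compat {x y : OrthantSpace G} (h : OrthantCompat G x.1 y.1) :
    dist x y = dist x.1 y.1 :=
  le_antisymm (dist_le_of_chain (.single h)) (dist_coe_le x y)

instance : Zero (OrthantSpace G) :=
  ⟨⟨0, fun _ => le_rfl, fun _ => le_rfl, fun _ _ _ hi _ => by simp at hi⟩⟩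

omit [Fintype ι] in
lemma coe_zero : (0 : OrthantSpace G).1 = 0 := rfl

lemma dist_zero_right (x : OrthantSpace G) : dist x 0 = ‖x.1‖ := by
  rw [dist_eq_of_compat (by rw [coe_zero]; exact x.2.zero_right), coe_zero, _root_.dist_zero_right]

end OrthantSpace

/-! ### Coordinate projections and the product structure of a star. -/

section restrict

variable {ι : Type*} {G : SimpleGraph ι}

open Classical in
/-- Replace the coordinates outside `S` by zero. -/
noncomputable def restrictCoords (S : Set ι) (x : EuclideanSpace ℝ ι) : EuclideanSpace ℝ ι :=
  WithLp.toLp 2 fun i => if i ∈ S then x i else 0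

open Classical in
/-- Replace the coordinates that are not adjacent to `v` by zero, and the coordinate `v` by `h`. -/
noncomputable def coneCoords (G : SimpleGraph ι) (v : ι) (x : EuclideanSpace ℝ ι) (h : ℝ) :
    EuclideanSpace ℝ ι :=
  WithLp.toLp 2 fun i => if i = v then h else if G.Adj v i then x i else 0

open Classical in
lemma restrictCoords_apply (S : Set ι) (x : EuclideanSpace ℝ ι) (i : ι) :
    restrictCoords S x i = if i ∈ S then x i else 0 := rfl

open Classical in
lemma coneCoords_apply (v : ι) (x : EuclideanSpace ℝ ι) (h : ℝ) (i : ι) :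
    coneCoords G v x h i = if i = v then h else if G.Adj v i then x i else 0 := rfl

variable {x y : EuclideanSpace ℝ ι} {l : ℝ}

lemma OrthantCompat.restrictCoords (h : OrthantCompat G x y) (S : Set ι) :
    OrthantCompat G (restrictCoords S x) (restrictCoords S y) := by
  refine ⟨fun i => ?_, fun i => ?_, fun i j hij hi hj => h.2.2 i j hij ?_ ?_⟩
  · rw [restrictCoords_apply]; split_ifs; exacts [h.1 i, le_rfl]
  · rw [restrictCoords_apply]; split_ifs; exacts [h.2.1 i, le_rfl]
  · simp only [restrictCoords_apply] at hi; split_ifs at hi <;> simp_all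
  · simp only [restrictCoords_apply] at hj; split_ifs at hj <;> simp_all

lemma OrthantCompat.coneCoords (h : OrthantCompat G x y) (v : ι) {s t : ℝ} (hs : 0 ≤ s)
    (ht : 0 ≤ t) : OrthantCompat G (coneCoords G v x s) (coneCoords G v y t) := by
  refine ⟨fun i => ?_, fun i => ?_, fun i j hij hi hj => ?_⟩
  · rw [coneCoords_apply]; split_ifs; exacts [hs, h.1 i, le_rfl]
  · rw [coneCoords_apply]; split_ifs; exacts [ht, h.2.1 i, le_rfl]
  · simp only [coneCoords_apply] at hi hj
    by_cases hiv : i = v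
    · subst hiv
      rw [if_neg (Ne.symm hij), if_neg (Ne.symm hij)] at hj
      by_contra hn
      simp [hn] at hj
    · rw [if_neg hiv, if_neg hiv] at hi
      by_cases hi' : G.Adj v i
      · by_cases hjv : j = v
        · rw [hjv]; exact hi'.symm
        · rw [if_neg hjv, if_neg hjv] at hj
          by_cases hj' : G.Adj v j
          · rw [if_pos hi', if_pos hi'] at hi
            rw [if_pos hj', if_pos hj'] at hj
            exact h.2.2 i j hij hi hj
          · simp [hj'] at hj
      · simp [hi'] at hi

variable [Fintype ι]

lemma dist_restrictCoords_le (S : Set ι) (x y : EuclideanSpace ℝ ι) :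
    dist (restrictCoords S x) (restrictCoords S y) ≤ dist x y := by
  rw [EuclideanSpace.dist_eq, EuclideanSpace.dist_eq]
  gcongr with i
  rw [restrictCoords_apply, restrictCoords_apply]
  split_ifs
  · rfl
  · simp

lemma dist_coneCoords_sq (v : ι) (x y : EuclideanSpace ℝ ι) (s t : ℝ) :
    dist (coneCoords G v x s) (coneCoords G v y t) ^ 2 =
      dist (restrictCoords (G.neighborSet v) x) (restrictCoords (G.neighborSet v) y) ^ 2
        + (s - t) ^ 2 := by
  classical
  rw [EuclideanSpace.dist_sq_eq, EuclideanSpace.dist_sq_eq]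
  have : (s - t) ^ 2 = ∑ i, if i = v then (s - t) ^ 2 else 0 := by simp
  rw [this, ← Finset.sum_add_distrib]
  refine Finset.sum_congr rfl fun i _ => ?_
  simp only [coneCoords_apply, restrictCoords_apply, SimpleGraph.mem_neighborSet, Real.dist_eq,
    sq_abs]
  by_cases hi : i = v
  · subst hi; simp
  · simp [hi]

lemma dist_restrictCoords_sq_add_le (v : ι) (x y : EuclideanSpace ℝ ι) :
    dist (restrictCoords (G.neighborSet v) x) (restrictCoords (G.neighborSet v) y) ^ 2
        + (x v - y v) ^ 2 ≤ dist x y ^ 2 := by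
  rw [← dist_coneCoords_sq (G := G), EuclideanSpace.dist_sq_eq, EuclideanSpace.dist_sq_eq]
  refine Finset.sum_le_sum fun i _ => ?_
  simp only [coneCoords_apply]
  split_ifs with h
  · rw [h]
  · rfl
  · simp

lemma OrthantChain.restrictCoords (h : OrthantChain G x y l) (S : Set ι) :
    ∃ m ≤ l, OrthantChain G (restrictCoords S x) (restrictCoords S y) m := by
  induction h with
  | nil x h => exact ⟨0, le_rfl, .nil _ (h.restrictCoords S)⟩
  | cons x y z l hxy _ ih =>
    obtain ⟨m, hm, h⟩ := ih
    exact ⟨_, add_le_add (dist_restrictCoords_le S x y) hm, .cons _ _ _ _ (hxy.restrictCoords S) h⟩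

end restrict

lemma sqrt_sq_add_sq_add_le (a b c d : ℝ) :
    √((a + b) ^ 2 + (c + d) ^ 2) ≤ √(a ^ 2 + c ^ 2) + √(b ^ 2 + d ^ 2) := by
  have := norm_add_le (⟨a, c⟩ : ℂ) ⟨b, d⟩
  simpa [Complex.norm_def, Complex.normSq_apply, ← sq] using this

lemma sqrt_sq_add_sq_mono {a b c : ℝ} (ha : 0 ≤ a) (h : a ≤ b) :
    √(a ^ 2 + c ^ 2) ≤ √(b ^ 2 + c ^ 2) := by
  gcongr

/-- A right triangle can be cut into two similar ones. -/
lemma exists_sqrt_add_sqrt_eq {a b s t : ℝ} (ha : 0 ≤ a) (hb : 0 ≤ b) (hs : 0 ≤ s) (ht : 0 ≤ t) :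
    ∃ r, 0 ≤ r ∧ √(a ^ 2 + (s - r) ^ 2) + √(b ^ 2 + (r - t) ^ 2) = √((a + b) ^ 2 + (s - t) ^ 2) := by
  rcases (add_nonneg ha hb).eq_or_lt with h | h
  · have ha0 : a = 0 := by linarith
    have hb0 : b = 0 := by linarith
    exact ⟨s, hs, by simp [ha0, hb0]⟩
  · refine ⟨(b * s + a * t) / (a + b), by positivity, ?_⟩
    have e1 : a ^ 2 + (s - (b * s + a * t) / (a + b)) ^ 2 =
        (a / (a + b)) ^ 2 * ((a + b) ^ 2 + (s - t) ^ 2) := by field_simp; ring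
    have e2 : b ^ 2 + ((b * s + a * t) / (a + b) - t) ^ 2 =
        (b / (a + b)) ^ 2 * ((a + b) ^ 2 + (s - t) ^ 2) := by field_simp; ring
    rw [e1, e2, Real.sqrt_mul (by positivity), Real.sqrt_mul (by positivity),
      Real.sqrt_sq (by positivity), Real.sqrt_sq (by positivity), ← add_mul, ← add_div,
      div_self h.ne', one_mul]

namespace OrthantSpace

variable {ι : Type*} [Fintype ι] {G : SimpleGraph ι}

/-- Replace the coordinates outside `S` by zero. -/
noncomputable def restrict (S : Set ι) (x : OrthantSpace G) : OrthantSpace G :=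
  ⟨restrictCoords S x.1, x.2.restrictCoords S⟩

/-- The point of height `h` over the projection of `x` to the link of `v`. -/
noncomputable def cone (v : ι) (x : OrthantSpace G) (h : ℝ) (hh : 0 ≤ h) : OrthantSpace G :=
  ⟨coneCoords G v x.1 h, x.2.coneCoords v hh hh⟩

lemma dist_restrict_le (S : Set ι) (x y : OrthantSpace G) :
    dist (restrict S x) (restrict S y) ≤ dist x y := by
  refine le_dist fun l h => ?_
  obtain ⟨m, hm, h'⟩ := h.restrictCoords S
  exact (dist_le_of_chain h').trans hm

omit [Fintype ι] in
lemma restrict_eq_self {S : Set ι} {x : OrthantSpace G} (h : ∀ i, x.1 i ≠ 0 → i ∈ S) :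
    restrict S x = x := by
  apply Subtype.ext
  ext i
  change restrictCoords S x.1 i = _
  rw [restrictCoords_apply]
  split_ifs with hi
  · rfl
  · by_contra h'
    exact hi (h i (Ne.symm h'))

omit [Fintype ι] in
lemma cone_restrict {v : ι} {x : OrthantSpace G} (h : ∀ i, x.1 i ≠ 0 → i = v ∨ G.Adj v i) :
    cone v x (x.1 v) (x.2.1 v) = x := by
  apply Subtype.ext
  ext i
  change coneCoords G v x.1 (x.1 v) i = _
  rw [coneCoords_apply]
  split_ifs with hi hi'
  · rw [hi]
  · rfl
  · by_contra h'
    have := h i (Ne.symm h')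
    tauto

/-- Each edge of a chain has Euclidean length at least the hypotenuse formed by its link part and
its v-part; Minkowski's inequality in the plane adds the edges up. -/
lemma dist_restrict_sq_add_le (v : ι) (x y : OrthantSpace G) :
    dist (restrict (G.neighborSet v) x) (restrict (G.neighborSet v) y) ^ 2
      + (x.1 v - y.1 v) ^ 2 ≤ dist x y ^ 2 := by
  have key : ∀ {x y l} (h : OrthantChain G x y l),
      √(dist (restrict (G.neighborSet v) ⟨x, h.left⟩) (restrict (G.neighborSet v) ⟨y, h.right⟩) ^ 2
        + (x v - y v) ^ 2) ≤ l := by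
    intro x y l h
    induction h with
    | nil x h => simp
    | cons x y z l hxy h ih =>
      refine ((?_ : _ ≤ _).trans (sqrt_sq_add_sq_add_le
        (dist (restrict (G.neighborSet v) ⟨x, hxy.left⟩) (restrict (G.neighborSet v) ⟨y, hxy.right⟩))
        (dist (restrict (G.neighborSet v) ⟨y, h.left⟩) (restrict (G.neighborSet v) ⟨z, h.right⟩))
        (x v - y v) (y v - z v))).trans (add_le_add ?_ ih)
      · rw [sub_add_sub_cancel]
        exact sqrt_sq_add_sq_mono dist_nonneg (dist_triangle _ _ _)
      · refine Real.sqrt_le_iff.2 ⟨dist_nonneg, ?_⟩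
        rw [dist_eq_of_compat (hxy.restrictCoords _)]
        exact dist_restrictCoords_sq_add_le v x y
  have := le_dist (x := x) (y := y) (b := √(dist (restrict (G.neighborSet v) x)
    (restrict (G.neighborSet v) y) ^ 2 + (x.1 v - y.1 v) ^ 2)) fun l h => key h
  exact Real.sqrt_le_iff.1 this |>.2

/-- The chain is lifted with heights interpolated in proportion to length, so that its edges are
bounded by consecutive pieces of one hypotenuse with legs l and |s - t|. -/
lemma dist_cone_le (v : ι) {x y : EuclideanSpace ℝ ι} {l : ℝ} (h : OrthantChain G x y l) :
    ∀ {s t : ℝ} (hs : 0 ≤ s) (ht : 0 ≤ t),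
      dist (cone v ⟨x, h.left⟩ s hs) (cone v ⟨y, h.right⟩ t ht) ≤ √(l ^ 2 + (s - t) ^ 2) := by
  induction h with
  | nil x h =>
    intro s t hs ht
    rw [dist_eq_of_compat (h.coneCoords v hs ht)]
    refine Real.le_sqrt_of_sq_le ?_
    change dist (coneCoords G v x s) (coneCoords G v x t) ^ 2 ≤ _
    rw [dist_coneCoords_sq]
    simp
  | cons x y z l hxy h ih =>
    intro s t hs ht
    obtain ⟨r, hr, e⟩ := exists_sqrt_add_sqrt_eq (dist_nonneg (x := x) (y := y))
      (dist_nonneg.trans h.dist_le) hs ht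
    rw [← e]
    refine (dist_triangle _ (cone v ⟨y, h.left⟩ r hr) _).trans (add_le_add ?_ (ih hr ht))
    rw [dist_eq_of_compat (hxy.coneCoords v hs hr)]
    refine Real.le_sqrt_of_sq_le ?_
    change dist (coneCoords G v x s) (coneCoords G v y r) ^ 2 ≤ _
    rw [dist_coneCoords_sq]
    gcongr
    exact dist_restrictCoords_le _ _ _

omit [Fintype ι] in
lemma cone_congr (v : ι) (x : OrthantSpace G) (h : ℝ) (hh : 0 ≤ h) :
    cone v (restrict (G.neighborSet v) x) h hh = cone v x h hh := by
  apply Subtype.ext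
  ext i
  change coneCoords G v (restrictCoords _ x.1) h i = coneCoords G v x.1 h i
  by_cases h : G.Adj v i <;> simp [coneCoords_apply, restrictCoords_apply, h]

/-- The closed star of a vertex is the product of a half-line and the cone over the link. -/
lemma dist_sq_of_mem_star (v : ι) {x y : OrthantSpace G}
    (hx : ∀ i, x.1 i ≠ 0 → i = v ∨ G.Adj v i) (hy : ∀ i, y.1 i ≠ 0 → i = v ∨ G.Adj v i) :
    dist x y ^ 2 = dist (restrict (G.neighborSet v) x) (restrict (G.neighborSet v) y) ^ 2
      + (x.1 v - y.1 v) ^ 2 := by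
  refine le_antisymm ?_ (dist_restrict_sq_add_le v x y)
  set d := dist (restrict (G.neighborSet v) x) (restrict (G.neighborSet v) y)
  have h1 : ∀ ε : ℝ, 0 < ε → dist x y ^ 2 ≤ (d + ε) ^ 2 + (x.1 v - y.1 v) ^ 2 := by
    intro ε hε
    obtain ⟨l, hl, h⟩ := exists_chain_lt (lt_add_of_pos_right d hε)
    have := dist_cone_le v h (x.2.1 v) (y.2.1 v)
    change dist (cone v (restrict (G.neighborSet v) x) _ _)
      (cone v (restrict (G.neighborSet v) y) _ _) ≤ _ at this
    rw [cone_congr, cone_congr, cone_restrict hx, cone_restrict hy] at this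
    have h0 : 0 ≤ l := dist_nonneg.trans h.dist_le
    calc dist x y ^ 2 ≤ √(l ^ 2 + (x.1 v - y.1 v) ^ 2) ^ 2 := by gcongr
      _ = l ^ 2 + (x.1 v - y.1 v) ^ 2 := Real.sq_sqrt (by positivity)
      _ ≤ _ := by gcongr
  have hc : Filter.Tendsto (fun ε : ℝ => (d + ε) ^ 2 + (x.1 v - y.1 v) ^ 2)
      (nhdsWithin 0 (Set.Ioi 0)) (nhds ((d + 0) ^ 2 + (x.1 v - y.1 v) ^ 2)) :=
    ((by fun_prop : Continuous fun ε : ℝ => (d + ε) ^ 2 + (x.1 v - y.1 v) ^ 2).tendsto 0).mono_left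
      nhdsWithin_le_nhds
  have := ge_of_tendsto hc (Filter.eventually_of_mem self_mem_nhdsWithin h1)
  simpa using this

/-- The crossing point is the last vertex of the chain before the v-coordinate first becomes
positive, or the end of the chain. In the first case it shares an orthant with a point whose support
contains v, so its own support consists of neighbours of v. -/
lemma exists_crossing_chain (v : ι) {x y : EuclideanSpace ℝ ι} {l : ℝ} (h : OrthantChain G x y l)
    (hx : x v = 0) (hy : ∀ i, y i ≠ 0 → i = v ∨ G.Adj v i) :
    ∃ c l₁ l₂, OrthantChain G x c l₁ ∧ OrthantChain G c y l₂ ∧ l₁ + l₂ = l ∧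
      ∀ i, c i ≠ 0 → G.Adj v i := by
  induction h with
  | nil x h =>
    refine ⟨x, 0, 0, .nil x h, .nil x h, by simp, fun i hi => ?_⟩
    rcases hy i hi with rfl | h
    · exact absurd hx hi
    · exact h
  | cons x y z l hxy h ih =>
    by_cases hv : y v = 0
    · obtain ⟨c, l₁, l₂, h1, h2, h3, h4⟩ := ih hv hy
      exact ⟨c, dist x y + l₁, l₂, .cons _ _ _ _ hxy h1, h2, by rw [← h3]; ring, h4⟩
    · refine ⟨x, 0, dist x y + l, .nil x hxy.left, .cons _ _ _ _ hxy h, by simp, fun i hi => ?_⟩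
      exact hxy.2.2 v i (by rintro rfl; exact hi hx) (Or.inr hv) (Or.inl hi)

end OrthantSpace

/-! ### The orthant space is CAT(0): induction on the vertices. -/

namespace OrthantSpace

variable {ι : Type*} [Fintype ι] {G : SimpleGraph ι}

/-- The identity, from the Euclidean metric to the length metric. -/
def ofEuclidean (x : {x : EuclideanSpace ℝ ι // OrthantCompat G x x}) : OrthantSpace G := x

/-- The metric of the orthant space induces the Euclidean topology. -/
lemma continuous_of_euclidean :
    Continuous (ofEuclidean : _ → OrthantSpace G) := by
  rw [continuous_iff_continuousAt]
  intro x
  rw [ContinuousAt, tendsto_iff_dist_tendsto_zero]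
  have h1 : Filter.Tendsto (fun y : {x : EuclideanSpace ℝ ι // OrthantCompat G x x} =>
      dist y.1 x.1) (nhds x) (nhds 0) :=
    tendsto_iff_dist_tendsto_zero.1 (continuous_subtype_val.tendsto x)
  refine h1.congr' ?_
  have h2 : ∀ i, ∀ᶠ y : {x : EuclideanSpace ℝ ι // OrthantCompat G x x} in nhds x,
      x.1 i ≠ 0 → y.1 i ≠ 0 := by
    intro i
    by_cases hi : x.1 i = 0
    · simp [hi]
    · have : Continuous fun y : {x : EuclideanSpace ℝ ι // OrthantCompat G x x} => y.1 i := by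
        fun_prop
      filter_upwards [this.continuousAt.eventually_ne hi] with y hy _ using hy
  filter_upwards [Filter.eventually_all.2 h2] with y hy
  exact (dist_eq_of_compat (x := ofEuclidean y) (y := ofEuclidean x) (OrthantCompat.of_subset x.2.1 y.2 hy).symm).symm

omit [Fintype ι] in
lemma orthantCompat_self_iff {x : EuclideanSpace ℝ ι} : OrthantCompat G x x ↔
    (∀ i, 0 ≤ x i) ∧ ∀ i j, i ≠ j → ¬ G.Adj i j → x i = 0 ∨ x j = 0 := by
  constructor
  · intro h
    refine ⟨h.1, fun i j hij hn => ?_⟩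
    by_contra hc
    push Not at hc
    exact hn (h.2.2 i j hij (Or.inl hc.1) (Or.inl hc.2))
  · intro h
    refine ⟨h.1, h.1, fun i j hij hi hj => ?_⟩
    by_contra hn
    have := h.2 i j hij hn
    tauto

lemma isCompact_face (S : Set ι) (R : ℝ) :
    IsCompact {x : OrthantSpace G | (∀ i ∉ S, x.1 i = 0) ∧ ‖x.1‖ ≤ R} := by
  have h1 : IsClosed {x : EuclideanSpace ℝ ι | OrthantCompat G x x} := by
    simp only [orthantCompat_self_iff, Set.ofPred_and, Set.ofPred_forall, Set.ofPred_or]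
    refine .inter (isClosed_iInter fun i => isClosed_le continuous_const (by fun_prop))
      (isClosed_iInter fun i => isClosed_iInter fun j => isClosed_iInter fun _ =>
        isClosed_iInter fun _ => .union (isClosed_eq (by fun_prop) continuous_const)
          (isClosed_eq (by fun_prop) continuous_const))
  have h2 : IsClosed {x : EuclideanSpace ℝ ι | (∀ i ∉ S, x i = 0) ∧ ‖x‖ ≤ R} := by
    simp only [Set.ofPred_and, Set.ofPred_forall]
    refine .inter (isClosed_iInter fun i => isClosed_iInter fun _ =>
      isClosed_eq (by fun_prop) continuous_const) (isClosed_le (by fun_prop) continuous_const)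
  have h3 : IsCompact {x : EuclideanSpace ℝ ι | (∀ i ∉ S, x i = 0) ∧ ‖x‖ ≤ R} := by
    refine Metric.isCompact_of_isClosed_isBounded h2
      (Metric.isBounded_closedBall (x := (0 : EuclideanSpace ℝ ι)) (r := R) |>.subset ?_)
    intro x hx
    simpa using hx.2
  have h4 := h1.isClosedEmbedding_subtypeVal.isCompact_preimage h3
  have h6 : ofEuclidean '' (Subtype.val ⁻¹' {x : EuclideanSpace ℝ ι | (∀ i ∉ S, x i = 0) ∧ ‖x‖ ≤ R})
      = {x : OrthantSpace G | (∀ i ∉ S, x.1 i = 0) ∧ ‖x.1‖ ≤ R} := by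
    ext x
    exact ⟨by rintro ⟨y, hy, rfl⟩; exact hy, fun hx => ⟨x, hx, rfl⟩⟩
  rw [← h6]
  exact h4.image continuous_of_euclidean

/-- A geodesic from the closed star of `v` to a face not containing `v` crosses the link of `v`. -/
lemma exists_crossing (v : ι) (T : Set ι) (hvT : v ∉ T) {x y : OrthantSpace G}
    (hx : ∀ i ∉ T, x.1 i = 0) (hy : ∀ i, y.1 i ≠ 0 → i = v ∨ i ∈ T ∧ G.Adj v i) :
    ∃ c : OrthantSpace G, (∀ i ∉ {i | i ∈ T ∧ G.Adj v i}, c.1 i = 0) ∧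
      dist y x = dist y c + dist c x := by
  set S : Set ι := {i | i ∈ T ∧ G.Adj v i} with hS
  -- Almost shortest chains cross the link of v. Restricting coordinates to T ∪ {v} is a 1-Lipschitz
  -- retraction fixing x and y, and it moves the crossing point into the face over S.
  have approx : ∀ ε : ℝ, 0 < ε → ∃ c : OrthantSpace G, (∀ i ∉ S, c.1 i = 0) ∧
      dist x c + dist c y ≤ dist x y + ε := by
    intro ε hε
    obtain ⟨l, hl, h⟩ := exists_chain_lt (lt_add_of_pos_right (dist x y) hε)
    obtain ⟨c, l₁, l₂, h1, h2, h3, h4⟩ := exists_crossing_chain v h (hx v hvT)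
      (fun i hi => (hy i hi).imp_right And.right)
    let c' : OrthantSpace G := ⟨c, h1.right⟩
    have hxT : restrict (insert v T) x = x := restrict_eq_self fun i hi => by
      by_contra hn
      exact hi (hx i fun h => hn (Or.inr h))
    have hyT : restrict (insert v T) y = y := restrict_eq_self fun i hi =>
      (hy i hi).imp_right And.left
    refine ⟨restrict (insert v T) c', fun i hi => ?_, ?_⟩
    · change restrictCoords _ c i = 0
      rw [restrictCoords_apply]
      by_contra hn
      have hci : c i ≠ 0 ∧ i ∈ insert v T := by
        split_ifs at hn with h'
        · exact ⟨hn, h'⟩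
        · exact absurd rfl hn
      have ha := h4 i hci.1
      exact hi ⟨hci.2.resolve_left ha.ne', ha⟩
    · have k1 := dist_restrict_le (insert v T) x c'
      have k2 := dist_restrict_le (insert v T) c' y
      rw [hxT] at k1
      rw [hyT] at k2
      have k3 : dist x c' ≤ l₁ := dist_le_of_chain h1
      have k4 : dist c' y ≤ l₂ := dist_le_of_chain h2
      linarith
  -- All competitors with ε ≤ 1 lie in the ball of radius R, so compactness gives an exact crossing
  -- point.
  set R := ‖x.1‖ + dist x y + 1
  have hK := isCompact_face (G := G) S R
  have hbd : ∀ {c : OrthantSpace G} {ε : ℝ}, ε ≤ 1 → dist x c + dist c y ≤ dist x y + ε →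
      ‖c.1‖ ≤ R := by
    intro c ε hε h
    have h1 := dist_triangle c x 0
    rw [dist_zero_right, dist_zero_right, dist_comm] at h1
    have : 0 ≤ dist c y := dist_nonneg
    simp only [R]
    linarith
  obtain ⟨c₀, hc₀, hc₀'⟩ := approx 1 one_pos
  obtain ⟨c, hc, hmin⟩ := hK.exists_isMinOn ⟨c₀, hc₀, hbd le_rfl hc₀'⟩
    (f := fun c => dist x c + dist c y) (by fun_prop)
  refine ⟨c, hc.1, le_antisymm (dist_triangle _ _ _) ?_⟩
  refine le_of_forall_pos_le_add fun ε hε => ?_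
  obtain ⟨e, he, he'⟩ := approx (min ε 1) (lt_min hε one_pos)
  have h1 := hmin (a := e) ⟨he, hbd (min_le_right _ _) he'⟩
  simp only [Set.mem_ofPred_eq] at h1
  rw [dist_comm y x, dist_comm y c, dist_comm c x]
  have := min_le_left ε 1
  linarith

/-- The part of the closed star of `v` over a `CAT(0)` part of the link of `v` is `CAT(0)`. -/
lemma isCAT0On_star (v : ι) (T : Set ι)
    (hC : IsCAT0On {x : OrthantSpace G | ∀ i ∉ {i | i ∈ T ∧ G.Adj v i}, x.1 i = 0}) :
    IsCAT0On {x : OrthantSpace G | ∀ i, x.1 i ≠ 0 → i = v ∨ i ∈ T ∧ G.Adj v i} := by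
  have hr : ∀ x : OrthantSpace G, (∀ i, x.1 i ≠ 0 → i = v ∨ i ∈ T ∧ G.Adj v i) →
      ∀ i ∉ {i | i ∈ T ∧ G.Adj v i}, (restrict (G.neighborSet v) x).1 i = 0 := by
    intro x hx i hi
    change restrictCoords _ x.1 i = 0
    rw [restrictCoords_apply]
    by_contra hn
    have hxi : x.1 i ≠ 0 ∧ i ∈ G.neighborSet v := by
      split_ifs at hn with h'
      · exact ⟨hn, h'⟩
      · exact absurd rfl hn
    exact hi ⟨((hx i hxi.1).resolve_left fun h => G.loopless.irrefl v (h ▸ hxi.2)).1, hxi.2⟩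
  intro x hx y hy t ht
  -- Squared distances add in a product, and in the half-line the comparison is an equality at the
  -- interpolated height.
  obtain ⟨z, hz, h⟩ := hC _ (hr x hx) _ (hr y hy) t ht
  have hh : 0 ≤ (1 - t) * x.1 v + t * y.1 v :=
    add_nonneg (mul_nonneg (sub_nonneg.2 ht.2) (x.2.1 v)) (mul_nonneg ht.1 (y.2.1 v))
  have hcone : ∀ i, (cone v z _ hh).1 i ≠ 0 → i = v ∨ i ∈ T ∧ G.Adj v i := by
    intro i hi
    change coneCoords G v z.1 _ i ≠ 0 at hi
    rw [coneCoords_apply] at hi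
    split_ifs at hi with h1 h2
    · exact Or.inl h1
    · right
      by_contra hn
      exact hi (hz i hn)
    · exact absurd rfl hi
  have hrc : restrict (G.neighborSet v) (cone v z _ hh) = z := by
    apply Subtype.ext
    ext i
    change restrictCoords _ (coneCoords G v z.1 _) i = z.1 i
    by_cases hi : G.Adj v i
    · simp [restrictCoords_apply, coneCoords_apply, hi, hi.ne']
    · simp only [restrictCoords_apply, SimpleGraph.mem_neighborSet, hi, if_false]
      exact (hz i fun h => hi h.2).symm
  have hcv : (cone v z _ hh).1 v = (1 - t) * x.1 v + t * y.1 v := by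
    change coneCoords G v z.1 _ v = _
    simp [coneCoords_apply]
  refine ⟨cone v z _ hh, hcone, fun p hp => ?_⟩
  have key := h _ (hr p hp)
  have w : ∀ {x : OrthantSpace G}, (∀ i, x.1 i ≠ 0 → i = v ∨ i ∈ T ∧ G.Adj v i) →
      ∀ i, x.1 i ≠ 0 → i = v ∨ G.Adj v i := fun h i hi => (h i hi).imp_right And.right
  rw [dist_sq_of_mem_star v (w hp) (w hcone), dist_sq_of_mem_star v (w hp) (w hx),
    dist_sq_of_mem_star v (w hp) (w hy), dist_sq_of_mem_star v (w hx) (w hy), hrc, hcv]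
  linarith

/-- A geodesic in the closed star of `v` that meets the link of `v` in an interior point lies in
the link. -/
lemma star_face (v : ι) (T : Set ι) (hvT : v ∉ T)
    (hB : IsCAT0On {x : OrthantSpace G | ∀ i, x.1 i ≠ 0 → i = v ∨ i ∈ T ∧ G.Adj v i})
    {x y z : OrthantSpace G} (hx : ∀ i, x.1 i ≠ 0 → i = v ∨ i ∈ T ∧ G.Adj v i)
    (hy : ∀ i, y.1 i ≠ 0 → i = v ∨ i ∈ T ∧ G.Adj v i)
    (hz : ∀ i ∉ {i | i ∈ T ∧ G.Adj v i}, z.1 i = 0) {t : ℝ} (ht : t ∈ Set.Ioo (0 : ℝ) 1)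
    (h1 : dist x z ≤ t * dist x y) (h2 : dist z y ≤ (1 - t) * dist x y) :
    x.1 v = 0 ∧ y.1 v = 0 := by
  have hzv : z.1 v = 0 := hz v fun h => hvT h.1
  have hz' : ∀ i, z.1 i ≠ 0 → i = v ∨ i ∈ T ∧ G.Adj v i := by
    intro i hi
    right
    by_contra hn
    exact hi (hz i hn)
  have w : ∀ {x : OrthantSpace G}, (∀ i, x.1 i ≠ 0 → i = v ∨ i ∈ T ∧ G.Adj v i) →
      ∀ i, x.1 i ≠ 0 → i = v ∨ G.Adj v i := fun h i hi => (h i hi).imp_right And.right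
  have hcone : ∀ h (hh : 0 ≤ h) i, (cone v z h hh).1 i ≠ 0 → i = v ∨ i ∈ T ∧ G.Adj v i := by
    intro h hh i hi
    change coneCoords G v z.1 _ i ≠ 0 at hi
    rw [coneCoords_apply] at hi
    split_ifs at hi with h1 h2
    · exact Or.inl h1
    · exact hz' i hi
    · exact absurd rfl hi
  have hrc : ∀ h (hh : 0 ≤ h), restrict (G.neighborSet v) (cone v z h hh) = z := by
    intro h hh
    apply Subtype.ext
    ext i
    change restrictCoords _ (coneCoords G v z.1 _) i = z.1 i
    by_cases hi : G.Adj v i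
    · simp [restrictCoords_apply, coneCoords_apply, hi, hi.ne']
    · simp only [restrictCoords_apply, SimpleGraph.mem_neighborSet, hi, if_false]
      exact (hz i fun h => hi h.2).symm
  have hcv : ∀ h (hh : 0 ≤ h), (cone v z h hh).1 v = h := by
    intro h hh
    change coneCoords G v z.1 _ v = _
    simp [coneCoords_apply]
  have hrz : restrict (G.neighborSet v) z = z := restrict_eq_self fun i hi => by
    by_contra hn
    exact hi (hz i fun h => hn h.2)
  set X := dist z (restrict (G.neighborSet v) x) ^ 2
  set Y := dist z (restrict (G.neighborSet v) y) ^ 2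
  set D := dist x y ^ 2
  set m := (1 - t) * x.1 v + t * y.1 v with hm
  -- Comparison with the point at height h over z: the terms h² cancel and the rest is affine in h.
  -- Letting h grow forces the interpolated height m to be at most 0.
  have key : ∀ h : ℝ, 0 ≤ h → 2 * h * m ≤ (1 - t) * (X + x.1 v ^ 2) + t * (Y + y.1 v ^ 2)
      - t * (1 - t) * D := by
    intro h hh
    have := hB.comparison hx hy hz' (hcone h hh) ⟨ht.1.le, ht.2.le⟩ h1 h2
    rw [dist_sq_of_mem_star v (w (hcone h hh)) (w hz'), dist_sq_of_mem_star v (w (hcone h hh)) (w hx),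
      dist_sq_of_mem_star v (w (hcone h hh)) (w hy), hrc, hcv, hrz, hzv, dist_self] at this
    rw [hm]
    linarith
  have hxv := x.2.1 v
  have hyv := y.2.1 v
  have hx1 : 0 ≤ (1 - t) * x.1 v := mul_nonneg (by linarith [ht.2]) hxv
  have hy1 : 0 ≤ t * y.1 v := mul_nonneg ht.1.le hyv
  have hm0 : m ≤ 0 := by
    by_contra hpos
    push Not at hpos
    set K := (1 - t) * (X + x.1 v ^ 2) + t * (Y + y.1 v ^ 2) - t * (1 - t) * D with hK
    have h3 := key ((|K| + 1) / m) (by positivity)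
    have h4 : 2 * ((|K| + 1) / m) * m = 2 * (|K| + 1) := by field_simp
    rw [h4] at h3
    linarith [le_abs_self K, abs_nonneg K]
  constructor
  · have : (1 - t) * x.1 v = 0 := by linarith
    rcases mul_eq_zero.1 this with h | h
    · linarith [ht.2]
    · exact h
  · have : t * y.1 v = 0 := by linarith
    rcases mul_eq_zero.1 this with h | h
    · linarith [ht.1]
    · exact h

/-- The support of a point is a clique, so a point with positive v-coordinate lies in the star of v.
The face over T is thus the face over T \ {v} glued to the star along the face over the neighbours
of v in T. Strong induction is needed because the latter may be much smaller. -/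
theorem isCAT0On_face (T : Finset ι) : IsCAT0On {x : OrthantSpace G | ∀ i ∉ T, x.1 i = 0} := by
  classical
  induction T using Finset.strongInduction with
  | H T ih =>
    rcases T.eq_empty_or_nonempty with rfl | ⟨v, hv⟩
    · intro x hx y hy t ht
      have h0 : ∀ x : OrthantSpace G, x ∈ {x : OrthantSpace G | ∀ i ∉ (∅ : Finset ι), x.1 i = 0} →
          x = 0 := by
        intro x hx
        apply Subtype.ext
        ext i
        exact hx i (by simp)
      refine ⟨0, fun i _ => rfl, fun p hp => ?_⟩
      rw [h0 x hx, h0 y hy, h0 p hp]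
      simp
    · set T' := T.erase v with hT'
      set L := T'.filter (fun i => G.Adj v i) with hL
      have hLs : ∀ i, i ∈ L ↔ i ∈ {i | i ∈ (T' : Set ι) ∧ G.Adj v i} := by simp [hL]
      have hvT' : v ∉ (T' : Set ι) := by simp [hT']
      have hA := ih T' (Finset.erase_ssubset hv)
      have hC := ih L ((Finset.filter_subset _ _).trans_ssubset (Finset.erase_ssubset hv))
      simp only [hLs] at hC
      have hB := isCAT0On_star v _ hC
      have hu := IsCAT0On.union hA hB hC
        (fun x hx i hi => hx i fun h => hi h.1)
        (fun x hx i hi => by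
          right
          by_contra hn
          exact hi (hx i hn))
        (fun p hp x hx => exists_crossing v _ hvT' hx hp)
        (fun x hx y hy z hz t ht h1 h2 => by
          obtain ⟨hxv, hyv⟩ := star_face v _ hvT' hB hx hy hz ht h1 h2
          constructor
          · intro i hi
            by_contra hn
            exact hi ((hx i hn).resolve_left (by rintro rfl; exact hn hxv))
          · intro i hi
            by_contra hn
            exact hi ((hy i hn).resolve_left (by rintro rfl; exact hn hyv)))
      convert hu using 1
      ext x
      simp only [Set.mem_ofPred_eq, Set.mem_union]
      constructor
      · intro hx
        by_cases hxv : x.1 v = 0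
        · left
          intro i hi
          by_cases hiv : i = v
          · rw [hiv, hxv]
          · exact hx i fun h => hi (Finset.mem_erase.2 ⟨hiv, h⟩)
        · right
          intro i hi
          by_cases hiv : i = v
          · exact Or.inl hiv
          · refine Or.inr ⟨Finset.mem_coe.2 (Finset.mem_erase.2 ⟨hiv, ?_⟩),
              x.2.2.2 v i (Ne.symm hiv) (Or.inl hxv) (Or.inl hi)⟩
            by_contra hn
            exact hi (hx i hn)
      · rintro (hx | hx) i hi
        · exact hx i fun h => hi (Finset.mem_of_mem_erase h)
        · by_contra hn
          rcases hx i hn with rfl | h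
          · exact hi hv
          · exact hi (Finset.mem_of_mem_erase h.1)

/-- The orthant space of a graph is `CAT(0)`. -/
theorem exists_comparison_point (x y : OrthantSpace G) {t : ℝ} (ht : t ∈ Set.Icc (0 : ℝ) 1) :
    ∃ z : OrthantSpace G, ∀ p : OrthantSpace G, dist p z ^ 2 ≤
      (1 - t) * dist p x ^ 2 + t * dist p y ^ 2 - t * (1 - t) * dist x y ^ 2 := by
  obtain ⟨z, -, h⟩ := isCAT0On_face (G := G) Finset.univ x (by simp) y (by simp) t ht
  exact ⟨z, fun p => h p (by simp)⟩

end OrthantSpace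

/-! ### From local to global in a length space. -/

/-- In a length space, an additive relation between pairs of points and lengths that holds locally
for the distance holds for all lengths exceeding the distance. -/
theorem IsLengthSpace.rel_of_locally {P : Type*} [MetricSpace P] (hP : IsLengthSpace P)
    (Q : P → P → ℝ → Prop) (refl : ∀ x, Q x x 0)
    (trans : ∀ x y z l m, Q x y l → Q y z m → Q x z (l + m))
    (mono : ∀ x y l m, Q x y l → l ≤ m → Q x y m)
    (loc : ∀ x, ∀ᶠ y in nhds x, Q x y (dist x y) ∧ Q y x (dist x y)) (x y : P) {ε : ℝ}
    (hε : 0 < ε) : Q x y (dist x y + ε) := by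
  obtain ⟨γ, hγ⟩ := hP x y ε hε
  have hfin : ∀ t, eVariationOn γ (Set.Iic t) ≠ ⊤ := fun t =>
    ((eVariationOn.mono γ (Set.subset_univ _)).trans_lt (hγ.trans ENNReal.ofReal_lt_top)).ne
  set V : unitInterval → ℝ := fun t => (eVariationOn γ (Set.Iic t)).toReal with hV
  have hadd : ∀ s t, s ≤ t → V s + dist (γ s) (γ t) ≤ V t := by
    intro s t hst
    have h1 : eVariationOn γ (Set.Iic s) + eVariationOn γ {s, t} ≤ eVariationOn γ (Set.Iic t) := by
      refine (eVariationOn.add_le_union γ ?_).trans (eVariationOn.mono γ ?_)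
      · rintro a ha b (rfl | rfl)
        exacts [ha, le_trans ha hst]
      · rintro a (ha | rfl | rfl)
        exacts [le_trans ha hst, hst, le_refl a]
    rw [eVariationOn.pair] at h1
    have h2 := ENNReal.toReal_mono (hfin t) h1
    rwa [ENNReal.toReal_add (hfin s) (edist_ne_top _ _), edist_dist,
      ENNReal.toReal_ofReal dist_nonneg] at h2
  have hV0 : ∀ t, 0 ≤ V t := fun t => ENNReal.toReal_nonneg
  set good : unitInterval → Prop := fun t => Q (γ 0) (γ t) (V t) with hgood
  have h0 : good 0 := mono _ _ _ _ (refl _) (hV0 0)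
  have hloc : ∀ t : unitInterval, ∃ δ > 0, ∀ s, dist s t < δ →
      Q (γ t) (γ s) (dist (γ t) (γ s)) ∧ Q (γ s) (γ t) (dist (γ t) (γ s)) := by
    intro t
    exact Metric.eventually_nhds_iff.1 (γ.continuous.continuousAt.eventually (loc (γ t)))
  -- Continuity method along the path, with arc length V. Closedness applies the local hypothesis at
  -- the limit time and runs from an earlier point to it, hence the need for both directions in
  -- `loc`.
  set S : Set unitInterval := {t | ∀ s ≤ t, good s} with hS
  have hopen : IsOpen S := by
    rw [Metric.isOpen_iff]
    intro t ht
    obtain ⟨δ, hδ, h⟩ := hloc t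
    refine ⟨δ, hδ, fun u hu s hs => ?_⟩
    rcases le_total s t with hst | hst
    · exact ht s hst
    · have hd : dist s t < δ := by
        refine lt_of_le_of_lt ?_ (Metric.mem_ball.1 hu)
        have h1 : (t : ℝ) ≤ s := hst
        have h2 : (s : ℝ) ≤ u := hs
        rw [Subtype.dist_eq, Subtype.dist_eq, Real.dist_eq, Real.dist_eq,
          abs_of_nonneg (by linarith), abs_of_nonneg (by linarith)]
        linarith
      exact mono _ _ _ _ (trans _ _ _ _ _ (ht t le_rfl) (h s hd).1) (hadd t s hst)
  have hclosed : IsClosed S := by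
    refine isClosed_of_closure_subset fun t ht s hs => ?_
    rw [Metric.mem_closure_iff] at ht
    rcases hs.eq_or_lt with rfl | hst
    · obtain ⟨δ, hδ, h⟩ := hloc s
      obtain ⟨u, hu, hd⟩ := ht δ hδ
      rcases le_total s u with hsu | hsu
      · exact hu s hsu
      · have := trans _ _ _ _ _ (hu u le_rfl) (h u (by rwa [dist_comm])).2
        rw [dist_comm] at this
        exact mono _ _ _ _ this (hadd u s hsu)
    · obtain ⟨u, hu, hd⟩ := ht ((t : ℝ) - s) (sub_pos.2 hst)
      refine hu s ?_
      rw [Subtype.dist_eq, Real.dist_eq] at hd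
      have h1 : (s : ℝ) ≤ u := by linarith [le_abs_self ((t : ℝ) - u)]
      exact h1
  have huniv : S = Set.univ := IsClopen.eq_univ ⟨hclosed, hopen⟩
    ⟨0, fun s hs => by rwa [le_antisymm hs unitInterval.nonneg']⟩
  have h1 : good 1 := (huniv ▸ Set.mem_univ (1 : unitInterval) : (1 : unitInterval) ∈ S) 1 le_rfl
  rw [hgood] at h1
  simp only [γ.source, γ.target] at h1
  refine mono _ _ _ _ h1 ?_
  refine ENNReal.toReal_le_of_le_ofReal (by positivity) ?_
  exact (eVariationOn.mono γ (Set.subset_univ _)).trans hγ.le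

/-! ### Metric of the Euclidean cone. -/

/-- The third side of a Euclidean triangle with sides `a` and `b` at angle `θ`. -/
noncomputable def coneDist (a b θ : ℝ) : ℝ := √(a ^ 2 + b ^ 2 - 2 * a * b * Real.cos θ)

section coneDist

variable {a b c θ θ₁ θ₂ : ℝ}

lemma coneDist_arg_nonneg (a b θ : ℝ) : 0 ≤ a ^ 2 + b ^ 2 - 2 * a * b * Real.cos θ := by
  nlinarith [sq_nonneg (a - b * Real.cos θ), Real.sin_sq_add_cos_sq θ,
    mul_nonneg (sq_nonneg b) (sq_nonneg (Real.sin θ))]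

lemma coneDist_sq (a b θ : ℝ) : coneDist a b θ ^ 2 = a ^ 2 + b ^ 2 - 2 * a * b * Real.cos θ :=
  Real.sq_sqrt (coneDist_arg_nonneg a b θ)

lemma coneDist_eq_norm (a b α β : ℝ) : coneDist a b (β - α) =
    ‖(⟨a * Real.cos α, a * Real.sin α⟩ - ⟨b * Real.cos β, b * Real.sin β⟩ : ℂ)‖ := by
  rw [coneDist, Complex.norm_def, Complex.normSq_apply]
  congr 1
  simp only [Complex.sub_re, Complex.sub_im]
  rw [Real.cos_sub]
  linear_combination -(a ^ 2) * Real.sin_sq_add_cos_sq α - b ^ 2 * Real.sin_sq_add_cos_sq β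

lemma coneDist_mono (ha : 0 ≤ a) (hb : 0 ≤ b) (h0 : 0 ≤ θ₁) (h : θ₁ ≤ θ₂) (hpi : θ₂ ≤ Real.pi) :
    coneDist a b θ₁ ≤ coneDist a b θ₂ := by
  apply Real.sqrt_le_sqrt
  have := Real.cos_le_cos_of_nonneg_of_le_pi h0 hpi h
  nlinarith [mul_le_mul_of_nonneg_left this (mul_nonneg ha hb)]

lemma coneDist_pi (ha : 0 ≤ a) (hb : 0 ≤ b) : coneDist a b Real.pi = a + b := by
  rw [coneDist, Real.cos_pi, ← Real.sqrt_sq (add_nonneg ha hb)]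
  congr 1; ring

lemma coneDist_zero_left (hb : 0 ≤ b) : coneDist 0 b θ = b := by
  rw [coneDist]; simp [Real.sqrt_sq hb]

lemma coneDist_zero_right (ha : 0 ≤ a) : coneDist a 0 θ = a := by
  rw [coneDist]; simp [Real.sqrt_sq ha]

lemma coneDist_self_zero (a : ℝ) : coneDist a a 0 = 0 := by
  rw [coneDist, Real.cos_zero]; ring_nf; simp

lemma coneDist_le_add_aux (a b c θ₁ θ₂ : ℝ) :
    coneDist a c (θ₁ + θ₂) ≤ coneDist a b θ₁ + coneDist b c θ₂ := by
  have h1 := coneDist_eq_norm a c 0 (θ₁ + θ₂)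
  have h2 := coneDist_eq_norm a b 0 θ₁
  have h3 := coneDist_eq_norm b c θ₁ (θ₁ + θ₂)
  rw [sub_zero] at h1 h2
  rw [add_sub_cancel_left] at h3
  rw [h1, h2, h3]
  exact norm_sub_le_norm_sub_add_norm_sub _ _ _

/-- When θ₁ + θ₂ exceeds π, θ₂ is first cut down to π - θ₁, which returns to the planar triangle
inequality. -/
lemma coneDist_triangle (ha : 0 ≤ a) (hb : 0 ≤ b) (hc : 0 ≤ c) (h1' : θ₁ ≤ Real.pi)
    (h2' : θ₂ ≤ Real.pi) (h : 0 ≤ θ) (hpi : θ ≤ Real.pi)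
    (hle : θ ≤ θ₁ + θ₂) : coneDist a c θ ≤ coneDist a b θ₁ + coneDist b c θ₂ := by
  rcases le_total (θ₁ + θ₂) Real.pi with hs | hs
  · exact (coneDist_mono ha hc h hle hs).trans (coneDist_le_add_aux a b c θ₁ θ₂)
  · calc coneDist a c θ ≤ coneDist a c (θ₁ + (Real.pi - θ₁)) :=
          coneDist_mono ha hc h (by linarith) (by linarith)
      _ ≤ coneDist a b θ₁ + coneDist b c (Real.pi - θ₁) := coneDist_le_add_aux _ _ _ _ _
      _ ≤ _ := by
          gcongr
          exact coneDist_mono hb hc (by linarith) (by linarith) h2'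

/-- A side of a Euclidean triangle crosses each ray issuing from the opposite vertex between the
other two sides. -/
lemma exists_coneDist_add_eq (ha : 0 ≤ a) (hb : 0 ≤ b) (h1 : 0 ≤ θ₁) (h2 : 0 ≤ θ₂)
    (hs : θ₁ + θ₂ < Real.pi) :
    ∃ r, 0 ≤ r ∧ coneDist a r θ₁ + coneDist r b θ₂ = coneDist a b (θ₁ + θ₂) := by
  rcases ha.eq_or_lt with rfl | ha
  · exact ⟨0, le_rfl, by simp [coneDist_zero_left, hb]⟩
  rcases hb.eq_or_lt with rfl | hb
  · exact ⟨0, le_rfl, by simp [coneDist_zero_right, ha.le]⟩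
  rcases h1.eq_or_lt with rfl | h1
  · exact ⟨a, ha.le, by simp [coneDist_self_zero]⟩
  have s1 : 0 < Real.sin θ₁ := Real.sin_pos_of_pos_of_lt_pi h1 (by linarith)
  have s2 : 0 ≤ Real.sin θ₂ := Real.sin_nonneg_of_nonneg_of_le_pi h2 (by linarith)
  have s3 : 0 < Real.sin (θ₁ + θ₂) := Real.sin_pos_of_pos_of_lt_pi (by linarith) hs
  set D := a * Real.sin θ₁ + b * Real.sin θ₂ with hD
  have hDpos : 0 < D := by positivity
  -- The value of r comes from areas: ab sin(θ₁ + θ₂) = ar sin θ₁ + rb sin θ₂. The ratio s in which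
  -- the ray divides the side is the ratio of areas.
  refine ⟨a * b * Real.sin (θ₁ + θ₂) / D, by positivity, ?_⟩
  set r := a * b * Real.sin (θ₁ + θ₂) / D with hr
  set s := a * Real.sin θ₁ / D with hsdef
  have hs0 : 0 ≤ s := by positivity
  have hs1 : s ≤ 1 := by
    rw [hsdef, div_le_one hDpos, hD]
    linarith [mul_nonneg hb.le s2]
  have e1 := coneDist_eq_norm a r 0 θ₁
  have e2 := coneDist_eq_norm r b θ₁ (θ₁ + θ₂)
  have e3 := coneDist_eq_norm a b 0 (θ₁ + θ₂)
  rw [sub_zero] at e1 e3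
  rw [add_sub_cancel_left] at e2
  have pt : (⟨r * Real.cos θ₁, r * Real.sin θ₁⟩ : ℂ) =
      (1 - (s : ℂ)) * ⟨a * Real.cos 0, a * Real.sin 0⟩ +
        (s : ℂ) * ⟨b * Real.cos (θ₁ + θ₂), b * Real.sin (θ₁ + θ₂)⟩ := by
    have key : Real.sin θ₂ + Real.sin θ₁ * Real.cos (θ₁ + θ₂) =
        Real.sin (θ₁ + θ₂) * Real.cos θ₁ := by
      rw [Real.sin_add, Real.cos_add]
      linear_combination (-Real.sin θ₂) * Real.sin_sq_add_cos_sq θ₁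
    have h1s : 1 - s = b * Real.sin θ₂ / D := by
      rw [hsdef, eq_div_iff hDpos.ne', sub_mul, div_mul_cancel₀ _ hDpos.ne', hD]; ring
    apply Complex.ext
    · simp
      rw [h1s, hr, hsdef]
      field_simp
      linear_combination -key
    · simp
      rw [hr, hsdef]
      field_simp
  rw [e1, e2, e3, pt]
  set A : ℂ := ⟨a * Real.cos 0, a * Real.sin 0⟩
  set B : ℂ := ⟨b * Real.cos (θ₁ + θ₂), b * Real.sin (θ₁ + θ₂)⟩
  have f1 : A - ((1 - (s : ℂ)) * A + s * B) = (s : ℂ) * (A - B) := by ring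
  have f2 : ((1 - (s : ℂ)) * A + s * B) - B = ((1 - s : ℝ) : ℂ) * (A - B) := by push_cast; ring
  rw [f1, f2, norm_mul, norm_mul, Complex.norm_real, Complex.norm_real, Real.norm_of_nonneg hs0,
    Real.norm_of_nonneg (by linarith)]
  ring

lemma dist_smul_eq_coneDist {E : Type*} [NormedAddCommGroup E] [InnerProductSpace ℝ E] {u v : E}
    (hu : ‖u‖ = 1) (hv : ‖v‖ = 1) (a b : ℝ) :
    dist (a • u) (b • v) = coneDist a b (InnerProductGeometry.angle u v) := by
  rw [dist_eq_norm, coneDist, ← Real.sqrt_sq (norm_nonneg (a • u - b • v)), norm_sub_sq_real,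
    norm_smul, norm_smul, hu, hv, real_inner_smul_left, real_inner_smul_right,
    ← InnerProductGeometry.cos_angle_mul_norm_mul_norm, hu, hv]
  congr 1
  simp
  ring

end coneDist

/-! ### Spherical coordinates, and the orthant space as the cone over P. -/

open InnerProductGeometry

/-- Spherical coordinates on an all-right spherical polyhedral space `P` with triangulation `K`: they
identify `P` with the set of nonnegative unit vectors supported on simplices of `K`, and
the distance in each simplex with the angle. -/
structure IsSphericalCoords {ι P : Type*} [Fintype ι] [MetricSpace P]
    (K : AbstractSimplicialComplex ι) (Ψ : P → EuclideanSpace ℝ ι) : Prop where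
  norm_eq : ∀ p, ‖Ψ p‖ = 1
  nonneg : ∀ p i, 0 ≤ Ψ p i
  exists_simplex : ∀ p, ∃ s ∈ K, ∀ i, Ψ p i ≠ 0 ↔ i ∈ s
  dist_eq : ∀ p q, ∀ s ∈ K, (∀ i, Ψ p i ≠ 0 → i ∈ s) → (∀ i, Ψ q i ≠ 0 → i ∈ s) →
    dist p q = angle (Ψ p) (Ψ q)
  surj : ∀ u : EuclideanSpace ℝ ι, ‖u‖ = 1 → (∀ i, 0 ≤ u i) → ∀ s ∈ K, (∀ i, u i ≠ 0 → i ∈ s) →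
    ∃ p, Ψ p = u
  eventually : ∀ p, ∀ᶠ q in nhds p, ∀ i, Ψ p i ≠ 0 → Ψ q i ≠ 0

open Classical in
/-- The graph of edges of a simplicial complex. -/
def AbstractSimplicialComplex.graph {ι : Type*} (K : AbstractSimplicialComplex ι) :
    SimpleGraph ι where
  Adj i j := i ≠ j ∧ {i, j} ∈ K
  symm := ⟨fun i j h => ⟨h.1.symm, by rw [Finset.pair_comm]; exact h.2⟩⟩
  loopless := ⟨fun i h => h.1 rfl⟩

lemma AbstractSimplicialComplex.mem_of_subset {ι : Type*} {K : AbstractSimplicialComplex ι}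
    {s t : Finset ι} (hs : s ∈ K) (hts : t ⊆ s) (ht : t.Nonempty) : t ∈ K :=
  (K.isRelLowerSet_faces hs).2 hts ht

namespace IsSphericalCoords

variable {ι P : Type*} [Fintype ι] [MetricSpace P] {K : AbstractSimplicialComplex ι}
  {Ψ : P → EuclideanSpace ℝ ι}

lemma compat_of_simplex (h : IsSphericalCoords K Ψ) {p q : P} {s : Finset ι} (hs : s ∈ K)
    (hp : ∀ i, Ψ p i ≠ 0 → i ∈ s) (hq : ∀ i, Ψ q i ≠ 0 → i ∈ s) :
    OrthantCompat K.graph (Ψ p) (Ψ q) := by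
  classical
  refine ⟨h.nonneg p, h.nonneg q, fun i j hij hi hj => ⟨hij, ?_⟩⟩
  have hi' : i ∈ s := hi.elim (hp i) (hq i)
  have hj' : j ∈ s := hj.elim (hp j) (hq j)
  convert AbstractSimplicialComplex.mem_of_subset hs (t := {i, j})
    (by intro k hk; simp at hk; rcases hk with rfl | rfl <;> assumption) ⟨i, by simp⟩

lemma ne_zero (h : IsSphericalCoords K Ψ) (p : P) : Ψ p ≠ 0 :=
  norm_ne_zero_iff.1 (by rw [h.norm_eq]; exact one_ne_zero)

lemma compat_self (h : IsSphericalCoords K Ψ) (p : P) : OrthantCompat K.graph (Ψ p) (Ψ p) := by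
  obtain ⟨s, hs, hp⟩ := h.exists_simplex p
  exact h.compat_of_simplex hs (fun i => (hp i).1) (fun i => (hp i).1)

lemma eventually_simplex (h : IsSphericalCoords K Ψ) (p : P) : ∀ᶠ q in nhds p, ∃ s ∈ K,
    (∀ i, Ψ p i ≠ 0 → i ∈ s) ∧ ∀ i, Ψ q i ≠ 0 → i ∈ s := by
  filter_upwards [h.eventually p] with q hq
  obtain ⟨s, hs, hqs⟩ := h.exists_simplex q
  exact ⟨s, hs, fun i hi => (hqs i).1 (hq i hi), fun i => (hqs i).1⟩

lemma exists_mem_support (h : IsSphericalCoords K Ψ) (p : P) : ∃ i, Ψ p i ≠ 0 := by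
  by_contra hn
  push Not at hn
  exact h.ne_zero p (by ext i; exact hn i)

/-- If the complex is flag, then each clique spans a simplex. -/
lemma exists_simplex_of_compat (hK : K.IsFlag) {u v : EuclideanSpace ℝ ι}
    (huv : OrthantCompat K.graph u v) (hu : ∃ i, u i ≠ 0) :
    ∃ s ∈ K, (∀ i, u i ≠ 0 → i ∈ s) ∧ ∀ i, v i ≠ 0 → i ∈ s := by
  classical
  refine ⟨Finset.univ.filter fun i => u i ≠ 0 ∨ v i ≠ 0, hK _ ?_ ?_, fun i hi => by simp [hi],
    fun i hi => by simp [hi]⟩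
  · obtain ⟨i, hi⟩ := hu
    exact ⟨i, by simp [hi]⟩
  · intro i hi j hj hij
    simp only [Finset.mem_filter, Finset.mem_univ, true_and] at hi hj
    convert (huv.2.2 i j hij hi hj).2

lemma dist_eq_of_compat (h : IsSphericalCoords K Ψ) (hK : K.IsFlag) {p q : P}
    (hpq : OrthantCompat K.graph (Ψ p) (Ψ q)) : dist p q = angle (Ψ p) (Ψ q) := by
  obtain ⟨s, hs, h1, h2⟩ := exists_simplex_of_compat hK hpq (h.exists_mem_support p)
  exact h.dist_eq p q s hs h1 h2

omit [Fintype ι] in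
lemma _root_.OrthantCompat.smul {G : SimpleGraph ι} {u v : EuclideanSpace ℝ ι}
    (h : OrthantCompat G u v) {a b : ℝ} (ha : 0 ≤ a) (hb : 0 ≤ b) :
    OrthantCompat G (a • u) (b • v) :=
  ⟨fun i => mul_nonneg ha (h.1 i), fun i => mul_nonneg hb (h.2.1 i), fun i j hij hi hj =>
    h.2.2 i j hij (hi.imp right_ne_zero_of_mul right_ne_zero_of_mul)
      (hj.imp right_ne_zero_of_mul right_ne_zero_of_mul)⟩

/-- The point at distance `a` from the apex on the ray of the Euclidean cone over `P` that
corresponds to `p`. -/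
noncomputable def conePoint (h : IsSphericalCoords K Ψ) (a : ℝ) (ha : 0 ≤ a) (p : P) :
    OrthantSpace K.graph :=
  ⟨a • Ψ p, (h.compat_self p).smul ha ha⟩

lemma norm_conePoint (h : IsSphericalCoords K Ψ) {a : ℝ} (ha : 0 ≤ a) (p : P) :
    ‖(h.conePoint a ha p).1‖ = a := by
  change ‖a • Ψ p‖ = a
  rw [norm_smul, h.norm_eq, mul_one, Real.norm_of_nonneg ha]

/-- The point of `P` under a point of the cone other than the apex. -/
lemma exists_eq_smul (h : IsSphericalCoords K Ψ) (hK : K.IsFlag) {u : EuclideanSpace ℝ ι}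
    (hu : OrthantCompat K.graph u u) (h0 : u ≠ 0) : ∃ p, u = ‖u‖ • Ψ p := by
  have hn : 0 < ‖u‖ := norm_pos_iff.2 h0
  have hex : ∃ i, u i ≠ 0 := by
    by_contra hc
    push Not at hc
    exact h0 (by ext i; exact hc i)
  obtain ⟨s, hs, hus, -⟩ := exists_simplex_of_compat hK hu hex
  obtain ⟨p, hp⟩ := h.surj (‖u‖⁻¹ • u) (by rw [norm_smul, norm_inv, norm_norm, inv_mul_cancel₀ hn.ne'])
    (fun i => mul_nonneg (inv_nonneg.2 hn.le) (hu.1 i)) s hs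
    (fun i hi => hus i (right_ne_zero_of_mul hi))
  exact ⟨p, by rw [hp, smul_smul, mul_inv_cancel₀ hn.ne', one_smul]⟩

/-- By flagness the ends of an edge avoiding the apex project into one simplex of P, so the edge has
the `coneDist` length of an actual distance in P, and `coneDist_triangle` adds the edges. A chain
through the apex has length at least a + b, the value at angle π. -/
lemma coneDist_le_of_chain (h : IsSphericalCoords K Ψ) (hK : K.IsFlag) {u w : EuclideanSpace ℝ ι}
    {l : ℝ} (hl : OrthantChain K.graph u w l) {y : P} {b : ℝ} (hb : 0 ≤ b) (hw : w = b • Ψ y) :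
    ∀ {a : ℝ}, 0 ≤ a → ∀ {x : P}, u = a • Ψ x → coneDist a b (min (dist x y) Real.pi) ≤ l := by
  have hnorm : ∀ {c : ℝ} (hc : 0 ≤ c) (q : P), ‖c • Ψ q‖ = c := fun hc q => h.norm_conePoint hc q
  have hpi : 0 ≤ Real.pi := Real.pi_pos.le
  induction hl with
  | nil u hu =>
    intro a ha x hx
    have hab : a = b := by rw [← hnorm ha x, ← hx, hw, hnorm hb]
    rcases ha.eq_or_lt with h0 | h0
    · rw [← hab, ← h0, coneDist_zero_left le_rfl]
    · have hxy : Ψ x = Ψ y := by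
        have : a • Ψ x = a • Ψ y := by rw [← hx, hw, hab]
        exact smul_right_injective _ h0.ne' this
      have hd : dist x y = 0 := by
        rw [h.dist_eq_of_compat hK (by rw [← hxy]; exact h.compat_self x), hxy,
          angle_self (h.ne_zero y)]
      rw [hd, min_eq_left hpi, hab, coneDist_self_zero]
  | cons u v w l huv hl ih =>
    intro a ha x hx
    rcases ha.eq_or_lt with h0 | h0
    · rw [← h0, coneDist_zero_left hb]
      have h1 := (OrthantChain.cons _ _ _ _ huv hl).dist_le
      have h2 : dist u w = b := by rw [hx, ← h0, zero_smul, dist_zero_left, hw, hnorm hb]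
      rwa [h2] at h1
    by_cases hv : v = 0
    · have h1 := hl.dist_le
      rw [hv, dist_zero_left, hw, hnorm hb] at h1
      rw [hv, dist_zero_right, hx, hnorm ha]
      calc _ ≤ coneDist a b Real.pi := coneDist_mono ha hb (le_min dist_nonneg hpi)
            (min_le_right _ _) le_rfl
        _ = a + b := coneDist_pi ha hb
        _ ≤ _ := by linarith
    · obtain ⟨q, hq⟩ := h.exists_eq_smul hK huv.right hv
      have hvpos : 0 < ‖v‖ := norm_pos_iff.2 hv
      have h1 := ih hw hvpos.le hq
      have hcomp : OrthantCompat K.graph (Ψ x) (Ψ q) := by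
        have := huv.smul (a := a⁻¹) (b := ‖v‖⁻¹) (by positivity) (by positivity)
        rwa [hx, hq, smul_smul, inv_mul_cancel₀ h0.ne', one_smul, hnorm hvpos.le, smul_smul,
          inv_mul_cancel₀ hvpos.ne', one_smul] at this
      have h2 : dist u v = coneDist a ‖v‖ (dist x q) := by
        rw [h.dist_eq_of_compat hK hcomp, ← dist_smul_eq_coneDist (h.norm_eq x) (h.norm_eq q), ← hx,
          ← hq]
      have h3 : dist x q ≤ Real.pi := by
        rw [h.dist_eq_of_compat hK hcomp]; exact angle_le_pi _ _
      rw [h2]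
      refine (coneDist_triangle ha hvpos.le hb h3 (min_le_right (dist q y) _)
        (le_min dist_nonneg hpi) (min_le_right _ _) ?_).trans (add_le_add le_rfl h1)
      rcases le_total (dist q y) Real.pi with h4 | h4
      · rw [min_eq_left h4]; exact (min_le_left _ _).trans (dist_triangle _ _ _)
      · rw [min_eq_right h4]; exact (min_le_right _ _).trans (le_add_of_nonneg_left dist_nonneg)

lemma coneDist_le_dist (h : IsSphericalCoords K Ψ) (hK : K.IsFlag) {a b : ℝ} (ha : 0 ≤ a)
    (hb : 0 ≤ b) (x y : P) : coneDist a b (min (dist x y) Real.pi) ≤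
      dist (h.conePoint a ha x) (h.conePoint b hb y) :=
  OrthantSpace.le_dist fun _ hl => h.coneDist_le_of_chain hK hl hb rfl ha rfl

/-- A path in P develops into a planar fan of triangles. If its total angle is below π, the chord
crosses every ray of the fan; otherwise the route through the apex has length a + b. The relation
must quantify over all radii, since the crossing radius is not known beforehand. -/
lemma dist_le_coneDist (h : IsSphericalCoords K Ψ) (hP : IsLengthSpace P) {a b : ℝ} (ha : 0 ≤ a)
    (hb : 0 ≤ b) (x y : P) : dist (h.conePoint a ha x) (h.conePoint b hb y) ≤
      coneDist a b (min (dist x y) Real.pi) := by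
  have hpi : 0 ≤ Real.pi := Real.pi_pos.le
  have hsum : ∀ a b (ha : 0 ≤ a) (hb : 0 ≤ b) x y,
      dist (h.conePoint a ha x) (h.conePoint b hb y) ≤ a + b := by
    intro a b ha hb x y
    refine (dist_triangle _ 0 _).trans ?_
    rw [dist_comm 0, OrthantSpace.dist_zero_right, OrthantSpace.dist_zero_right, h.norm_conePoint,
      h.norm_conePoint]
  have key := fun ε (hε : 0 < ε) => hP.rel_of_locally (fun x y l => 0 ≤ l ∧
    ∀ a b (ha : 0 ≤ a) (hb : 0 ≤ b), dist (h.conePoint a ha x) (h.conePoint b hb y) ≤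
      coneDist a b (min l Real.pi))
    (by
      intro x
      refine ⟨le_rfl, fun a b ha hb => ?_⟩
      rw [min_eq_left hpi, OrthantSpace.dist_eq_of_compat ((h.compat_self x).smul ha hb)]
      change dist (a • Ψ x) (b • Ψ x) ≤ _
      rw [dist_smul_eq_coneDist (h.norm_eq x) (h.norm_eq x),
        angle_self (h.ne_zero x)])
    (by
      rintro x y z l m ⟨hl, h1⟩ ⟨hm, h2⟩
      refine ⟨add_nonneg hl hm, fun a b ha hb => ?_⟩
      rcases lt_or_ge (l + m) Real.pi with hlt | hge
      · obtain ⟨r, hr, e⟩ := exists_coneDist_add_eq ha hb hl hm hlt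
        rw [min_eq_left hlt.le, ← e]
        have k1 := h1 a r ha hr
        have k2 := h2 r b hr hb
        rw [min_eq_left (by linarith)] at k1 k2
        exact (dist_triangle _ (h.conePoint r hr y) _).trans (add_le_add k1 k2)
      · rw [min_eq_right hge, coneDist_pi ha hb]
        exact hsum _ _ _ _ _ _)
    (by
      rintro x y l m ⟨hl, h1⟩ hlm
      refine ⟨hl.trans hlm, fun a b ha hb => (h1 a b ha hb).trans ?_⟩
      exact coneDist_mono ha hb (le_min hl hpi) (min_le_min_right _ hlm) (min_le_right _ _))
    (by
      intro x
      filter_upwards [h.eventually_simplex x] with y hy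
      obtain ⟨s, hs, hx, hy⟩ := hy
      have main : ∀ x y, (∀ i, Ψ x i ≠ 0 → i ∈ s) → (∀ i, Ψ y i ≠ 0 → i ∈ s) → ∀ a b (ha : 0 ≤ a)
          (hb : 0 ≤ b), dist (h.conePoint a ha x) (h.conePoint b hb y) ≤
            coneDist a b (min (dist x y) Real.pi) := by
        intro x y hx hy a b ha hb
        rw [OrthantSpace.dist_eq_of_compat ((h.compat_of_simplex hs hx hy).smul ha hb),
          h.dist_eq x y s hs hx hy, min_eq_left (angle_le_pi _ _)]
        change dist (a • Ψ x) (b • Ψ y) ≤ _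
        rw [dist_smul_eq_coneDist (h.norm_eq x) (h.norm_eq y)]
      refine ⟨⟨dist_nonneg, main x y hx hy⟩, dist_nonneg, fun a b ha hb => ?_⟩
      rw [dist_comm x y]
      exact main y x hy hx a b ha hb)
    x y hε
  have hc : Filter.Tendsto (fun ε : ℝ => coneDist a b (min (dist x y + ε) Real.pi))
      (nhdsWithin 0 (Set.Ioi 0)) (nhds (coneDist a b (min (dist x y + 0) Real.pi))) := by
    have : Continuous fun ε : ℝ => coneDist a b (min (dist x y + ε) Real.pi) := by
      unfold coneDist; fun_prop
    exact (this.tendsto 0).mono_left nhdsWithin_le_nhds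
  rw [add_zero] at hc
  exact ge_of_tendsto hc (Filter.eventually_of_mem self_mem_nhdsWithin
    fun ε hε => (key ε hε).2 a b ha hb)

/-- The metric of the orthant space is the metric of the Euclidean cone over `P`. -/
lemma dist_conePoint (h : IsSphericalCoords K Ψ) (hK : K.IsFlag) (hP : IsLengthSpace P) {a b : ℝ}
    (ha : 0 ≤ a) (hb : 0 ≤ b) (x y : P) :
    dist (h.conePoint a ha x) (h.conePoint b hb y) = coneDist a b (min (dist x y) Real.pi) :=
  le_antisymm (h.dist_le_coneDist hP ha hb x y) (h.coneDist_le_dist hK ha hb x y)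

end IsSphericalCoords

/-! ### From the CAT(0) cone to CAT(1): flag complexes. -/

/-- A point between two unit vectors is, up to scaling, on the chord joining them. -/
lemma exists_chord_point {E : Type*} [NormedAddCommGroup E] [InnerProductSpace ℝ E] {x y z : E}
    (hz : ‖z‖ = 1) (hxy : angle x y ≠ Real.pi) (h : angle x z + angle z y = angle x y) :
    ∃ t ∈ Set.Icc (0 : ℝ) 1, ∃ c : ℝ, 0 < c ∧ (1 - t) • x + t • y = c • z := by
  have hz0 : z ≠ 0 := norm_ne_zero_iff.1 (by rw [hz]; exact one_ne_zero)
  have hmem := ((angle_eq_angle_add_angle_iff hz0).1 h.symm).resolve_left hxy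
  obtain ⟨a, b, hab⟩ := Submodule.mem_span_pair.1 hmem
  have hab' : (a : ℝ) • x + (b : ℝ) • y = z := hab
  have ha : (0 : ℝ) ≤ a := a.2
  have hb : (0 : ℝ) ≤ b := b.2
  have hpos : 0 < (a : ℝ) + b := by
    rcases (add_nonneg ha hb).eq_or_lt with h0 | h0
    · exfalso
      apply hz0
      have h1 : (a : ℝ) = 0 := by linarith
      have h2 : (b : ℝ) = 0 := by linarith
      rw [← hab', h1, h2]; simp
    · exact h0
  refine ⟨b / (a + b), ⟨by positivity, by rw [div_le_one hpos]; linarith⟩, 1 / (a + b),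
    by positivity, ?_⟩
  have h1 : 1 - (b : ℝ) / (a + b) = 1 / (a + b) * a := by field_simp; ring
  have h2 : (b : ℝ) / (a + b) = 1 / (a + b) * b := by field_simp
  rw [h1, h2, mul_smul, mul_smul, ← smul_add, hab']

/-- The distance from the vertex of a triangle to a point of the opposite side (Stewart). -/
lemma dist_sq_combo {E : Type*} [NormedAddCommGroup E] [InnerProductSpace ℝ E] (p x y : E) (t : ℝ) :
    dist p ((1 - t) • x + t • y) ^ 2 =
      (1 - t) * dist p x ^ 2 + t * dist p y ^ 2 - t * (1 - t) * dist x y ^ 2 := by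
  have e1 : p - ((1 - t) • x + t • y) = (1 - t) • (p - x) + t • (p - y) := by module
  have e2 : x - y = (p - y) - (p - x) := by abel
  rw [dist_eq_norm, dist_eq_norm, dist_eq_norm, dist_eq_norm, e1, e2]
  generalize p - x = u
  generalize p - y = v
  rw [norm_add_sq_real, norm_sub_sq_real, norm_smul, norm_smul, real_inner_smul_left,
    real_inner_smul_right, mul_pow, mul_pow, Real.norm_eq_abs, Real.norm_eq_abs, sq_abs, sq_abs,
    real_inner_comm u v]
  ring

/-- The distance from the apex to a point of the base of an isosceles triangle bounds the
projection of the base to a line through the apex. -/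
lemma combo_cos_le {t u v c : ℝ} (hc : 0 ≤ c)
    (h : c ^ 2 = (1 - t) ^ 2 + t ^ 2 + 2 * t * (1 - t) * Real.cos (u + v)) :
    (1 - t) * Real.cos u + t * Real.cos v ≤ c := by
  refine abs_le_of_sq_le_sq' ?_ hc |>.2
  rw [h, Real.cos_add]
  nlinarith [sq_nonneg ((1 - t) * Real.sin u - t * Real.sin v), Real.sin_sq_add_cos_sq u,
    Real.sin_sq_add_cos_sq v]

namespace IsSphericalCoords

variable {ι P : Type*} [Fintype ι] [MetricSpace P] {K : AbstractSimplicialComplex ι}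
  {Ψ : P → EuclideanSpace ℝ ι}

/-- A length space with spherical coordinates in a flag complex has geodesics, for which the
comparison holds. -/
lemma exists_thin_point (h : IsSphericalCoords K Ψ) (hK : K.IsFlag) (hP : IsLengthSpace P)
    {x y : P} (hxy : dist x y < Real.pi) {E : Type*} [NormedAddCommGroup E] [InnerProductSpace ℝ E]
    {x' y' z' : E} (hx' : ‖x'‖ = 1) (hy' : ‖y'‖ = 1) (hz' : ‖z'‖ = 1)
    (hxy' : angle x' y' = dist x y) (hz : angle x' z' + angle z' y' = angle x' y') :
    ∃ z : P, ∀ p : P, ∀ p' : E, ‖p'‖ = 1 → angle p' x' = dist p x → angle p' y' = dist p y →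
      dist p x + dist x y + dist p y < 2 * Real.pi → dist p z ≤ angle p' z' := by
  have hpi : 0 ≤ Real.pi := Real.pi_pos.le
  obtain ⟨t, ht, c, hc, hcz⟩ := exists_chord_point hz' (by rw [hxy']; exact hxy.ne) hz
  have ht1 : 0 ≤ 1 - t := sub_nonneg.2 ht.2
  -- The chord point c z' has parameter t, and Z is its counterpart in the cone over P. The wanted z
  -- is the direction of Z, provided that Z is not the apex and has the same radius c.
  obtain ⟨Z, hZ⟩ := OrthantSpace.exists_comparison_point (h.conePoint 1 zero_le_one x)
    (h.conePoint 1 zero_le_one y) ht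
  set X := h.conePoint 1 zero_le_one x with hX
  set Y := h.conePoint 1 zero_le_one y with hY
  have hdist : ∀ {u' v' : E} (hu : ‖u'‖ = 1) (hv : ‖v'‖ = 1), dist u' v' = coneDist 1 1 (angle u' v') := by
    intro u' v' hu hv
    rw [← dist_smul_eq_coneDist hu hv, one_smul, one_smul]
  have hXY : dist X Y = dist x' y' := by
    rw [hX, hY, h.dist_conePoint hK hP, hdist hx' hy', hxy', min_eq_left hxy.le]
  have hcsq : c ^ 2 = 1 - t * (1 - t) * dist x' y' ^ 2 := by
    have := dist_sq_combo (0 : E) x' y' t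
    rw [hcz, dist_zero_left, dist_zero_left, dist_zero_left, norm_smul, hx', hy', hz', mul_one,
      Real.norm_of_nonneg hc.le] at this
    rw [this]; ring
  have hn : dist x' y' ^ 2 = 2 - 2 * Real.cos (dist x y) := by
    rw [hdist hx' hy', coneDist_sq, hxy']; ring
  have hXZ : dist X Z ^ 2 ≤ t ^ 2 * dist x' y' ^ 2 := by
    have := hZ X
    rw [dist_self, hXY] at this
    linarith
  have hYZ : dist Y Z ^ 2 ≤ (1 - t) ^ 2 * dist x' y' ^ 2 := by
    have := hZ Y
    rw [dist_self, dist_comm Y X, hXY] at this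
    linarith
  have hn2 : dist x' y' ^ 2 < 2 ^ 2 := by
    have : -1 < Real.cos (dist x y) := by
      rw [← Real.cos_pi]
      exact Real.cos_lt_cos_of_nonneg_of_le_pi dist_nonneg le_rfl hxy
    rw [hn]; linarith
  have hZ0 : Z.1 ≠ 0 := by
    intro h0
    have hZ0 : Z = 0 := Subtype.ext h0
    rw [hZ0, OrthantSpace.dist_zero_right, hX, h.norm_conePoint] at hXZ
    rw [hZ0, OrthantSpace.dist_zero_right, hY, h.norm_conePoint] at hYZ
    rw [← mul_pow] at hXZ hYZ
    have k1 := abs_le_of_sq_le_sq' hXZ (mul_nonneg ht.1 dist_nonneg) |>.2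
    have k2 := abs_le_of_sq_le_sq' hYZ (mul_nonneg ht1 dist_nonneg) |>.2
    have k3 := abs_lt_of_sq_lt_sq hn2 (by norm_num)
    linarith [le_abs_self (dist x' y')]
  obtain ⟨z, hz1⟩ := h.exists_eq_smul hK Z.2 hZ0
  set m := ‖Z.1‖ with hm
  have hm0 : 0 < m := norm_pos_iff.2 hZ0
  have hZz : Z = h.conePoint m hm0.le z := Subtype.ext hz1
  have hpz : ∀ p, dist (h.conePoint 1 zero_le_one p) Z ^ 2 =
      1 + m ^ 2 - 2 * m * Real.cos (min (dist p z) Real.pi) := by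
    intro p
    rw [hZz, h.dist_conePoint hK hP, coneDist_sq]; ring
  -- Averaging the bounds on |XZ|² and |YZ|² gives m² + c² ≤ 2m((1 - t) cos|xz| + t cos|yz|),
  -- distances being truncated at π. Since |xz| + |zy| ≥ |xy|, the bracket is at most c, so (m - c)²
  -- ≤ 0.
  have hmc : m = c := by
    rw [hX, hpz] at hXZ
    rw [hY, hpz] at hYZ
    set u := min (dist x z) (dist x y) with hu
    set v := dist x y - u with hv
    have hu0 : 0 ≤ u := le_min dist_nonneg dist_nonneg
    have hv0 : 0 ≤ v := sub_nonneg.2 (min_le_right _ _)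
    have hcu : Real.cos (min (dist x z) Real.pi) ≤ Real.cos u :=
      Real.cos_le_cos_of_nonneg_of_le_pi hu0 (min_le_right _ _) (min_le_min_left _ hxy.le)
    have hcv : Real.cos (min (dist y z) Real.pi) ≤ Real.cos v := by
      refine Real.cos_le_cos_of_nonneg_of_le_pi hv0 (min_le_right _ _) (le_min ?_ ?_)
      · rw [hv, hu]
        rcases le_total (dist x z) (dist x y) with h1 | h1
        · rw [min_eq_left h1]
          linarith [dist_triangle x z y, dist_comm z y]
        · rw [min_eq_right h1]
          linarith [dist_nonneg (x := y) (y := z)]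
      · linarith
    have hcomb := combo_cos_le (t := t) (u := u) (v := v) hc.le (by
      rw [hcsq, hn, hv, add_sub_cancel]; ring)
    have k1 := mul_le_mul_of_nonneg_left hcu ht1
    have k2 := mul_le_mul_of_nonneg_left hcv ht.1
    have k3 := mul_le_mul_of_nonneg_left ((add_le_add k1 k2).trans hcomb) hm0.le
    have k4 := mul_le_mul_of_nonneg_left hXZ ht1
    have k5 := mul_le_mul_of_nonneg_left hYZ ht.1
    have : (m - c) ^ 2 ≤ 0 := by nlinarith
    have := pow_eq_zero_iff two_ne_zero |>.1 (le_antisymm this (sq_nonneg _))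
    linarith
  refine ⟨z, fun p p' hp' hpx hpy hper => ?_⟩
  have hpx1 : dist p x ≤ Real.pi := hpx ▸ angle_le_pi _ _
  have hpy1 : dist p y ≤ Real.pi := hpy ▸ angle_le_pi _ _
  have k1 := hZ (h.conePoint 1 zero_le_one p)
  have k2 := dist_sq_combo p' x' y' t
  rw [hcz] at k2
  have k3 : dist p' (c • z') ^ 2 = 1 + c ^ 2 - 2 * c * Real.cos (angle p' z') := by
    have := dist_smul_eq_coneDist hp' hz' 1 c
    rw [one_smul] at this
    rw [this, coneDist_sq]; ring
  have k4 : dist (h.conePoint 1 zero_le_one p) X = dist p' x' := by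
    rw [hX, h.dist_conePoint hK hP, hdist hp' hx', hpx, min_eq_left hpx1]
  have k5 : dist (h.conePoint 1 zero_le_one p) Y = dist p' y' := by
    rw [hY, h.dist_conePoint hK hP, hdist hp' hy', hpy, min_eq_left hpy1]
  rw [k4, k5, hXY, ← k2, k3, hpz, hmc] at k1
  have k6 : Real.cos (angle p' z') ≤ Real.cos (min (dist p z) Real.pi) := by
    have : 2 * c * Real.cos (angle p' z') ≤ 2 * c * Real.cos (min (dist p z) Real.pi) := by linarith
    exact le_of_mul_le_mul_left this (by positivity)
  have k7 : min (dist p z) Real.pi ≤ angle p' z' := by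
    by_contra hlt
    push Not at hlt
    have := Real.cos_lt_cos_of_nonneg_of_le_pi (angle_nonneg p' z') (min_le_right _ _) hlt
    linarith
  -- The cone sees distances only up to π. If |pz| ≥ π, then the angle of p' and z' would be at
  -- least π, and the two triangle inequalities through x' and y' would make the perimeter at least
  -- 2π.
  rcases le_total (dist p z) Real.pi with h1 | h1
  · rwa [min_eq_left h1] at k7
  · exfalso
    rw [min_eq_right h1] at k7
    have a1 := angle_le_angle_add_angle p' x' z'
    have a2 := angle_le_angle_add_angle p' y' z'
    rw [angle_comm y' z'] at a2
    linarith

/-- The point z of `exists_thin_point` does not depend on p, so it serves p and q at once. -/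
theorem isCAT1 (h : IsSphericalCoords K Ψ) (hK : K.IsFlag) (hP : IsLengthSpace P) : IsCAT1 P := by
  intro p q x y hp hq p' q' x' y' hp' hq' z' hz' hsum
  have hxy : dist x y < Real.pi := by
    have := dist_triangle x p y
    rw [dist_comm x p, dist_comm p y] at this
    linarith
  obtain ⟨z, hz⟩ := h.exists_thin_point hK hP hxy hp'.norm_b hp'.norm_c hz' hp'.dist_bc hsum
  have h1 := hz p p' hp'.norm_a hp'.dist_ab
    (by rw [angle_comm, dist_comm]; exact hp'.dist_ca) (by rwa [dist_comm p y])
  have h2 := hz q q' hq'.norm_a hq'.dist_ab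
    (by rw [angle_comm, dist_comm]; exact hq'.dist_ca) (by rwa [dist_comm q y])
  calc dist p q ≤ dist p z + dist z q := dist_triangle _ _ _
    _ ≤ angle p' z' + angle z' q' := by
      rw [dist_comm z q, angle_comm z' q']; exact add_le_add h1 h2

end IsSphericalCoords

/-! ### All-right simplices are orthonormal; coordinates from a triangulation. -/

namespace SphericalSimplex

variable {σ : Type*} [Fintype σ]

/-- The vertices of a spherical simplex with right angles are orthonormal. -/
lemma IsAllRight.orthonormal {S : SphericalSimplex σ} (hS : S.IsAllRight) :
    Orthonormal ℝ S.vertex := by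
  classical
  refine ⟨S.norm_vertex, fun i j hij => ?_⟩
  set U : σ → Submodule ℝ (EuclideanSpace ℝ σ) := fun j =>
    Submodule.span ℝ (S.vertex '' {k | k ≠ i ∧ k ≠ j}) with hU
  -- By construction w j is orthogonal to the vertices other than i and j, and the right angle makes
  -- it orthogonal to vertex j too. So it is the component of vertex i orthogonal to all other
  -- vertices, independently of j. The difference of vertex i and w j then lies in U k for every k ≠
  -- i, and by linear independence these spans meet only in 0.
  set w : σ → EuclideanSpace ℝ σ := fun j => (U j)ᗮ.starProjection (S.vertex i) with hw
  have hsub : ∀ j x, x - (U j)ᗮ.starProjection x ∈ U j := by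
    intro j x
    have := Submodule.sub_starProjection_mem_orthogonal (K := (U j)ᗮ) x
    rwa [Submodule.orthogonal_orthogonal] at this
  have hw1 : ∀ j k, j ≠ i → k ≠ i → inner ℝ (w j) (S.vertex k) = 0 := by
    intro j k hj hk
    have hmem : w j ∈ (U j)ᗮ := Submodule.starProjection_apply_mem _ _
    by_cases hkj : k = j
    · subst hkj
      have h1 : inner ℝ (w k) ((U k)ᗮ.starProjection (S.vertex k)) = 0 :=
        inner_eq_zero_iff_angle_eq_pi_div_two _ _ |>.2 (hS i k (Ne.symm hk))
      have h2 : inner ℝ (w k) (S.vertex k - (U k)ᗮ.starProjection (S.vertex k)) = 0 :=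
        Submodule.inner_left_of_mem_orthogonal (hsub k _) hmem
      rw [inner_sub_right, h1, sub_zero] at h2
      exact h2
    · have hkU : S.vertex k ∈ S.vertex '' {k | k ≠ i ∧ k ≠ j} := ⟨k, ⟨hk, hkj⟩, rfl⟩
      exact Submodule.inner_left_of_mem_orthogonal (Submodule.subset_span hkU) hmem
  have hdiff : ∀ k, k ≠ i → w k = w j := by
    intro k hk
    have h1 : w k - w j ∈ Submodule.span ℝ (S.vertex '' {k | k ≠ i}) := by
      have e : w k - w j = (S.vertex i - w j) - (S.vertex i - w k) := by abel
      rw [e]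
      refine Submodule.sub_mem _ ?_ ?_
      · exact Submodule.span_mono (Set.image_mono fun k hk => hk.1) (hsub j _)
      · exact Submodule.span_mono (Set.image_mono fun k hk => hk.1) (hsub k _)
    have h2 : w k - w j ∈ (Submodule.span ℝ (S.vertex '' {k | k ≠ i}))ᗮ := by
      rw [Submodule.mem_orthogonal']
      intro u hu
      induction hu using Submodule.span_induction with
      | mem x hx =>
        obtain ⟨l, hl, rfl⟩ := hx
        rw [inner_sub_left, hw1 k l hk hl, hw1 j l (Ne.symm hij) hl, sub_zero]
      | zero => simp
      | add x y _ _ hx hy => rw [inner_add_right, hx, hy, add_zero]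
      | smul a x _ hx => rw [inner_smul_right, hx, mul_zero]
    rw [← sub_eq_zero]
    exact (Submodule.disjoint_def.1 (Submodule.orthogonal_disjoint _)) _ h1 h2
  set b := basisOfLinearIndependentOfCardEqFinrank' S.vertex S.linearIndependent (by simp) with hb
  have hbv : ∀ k, b k = S.vertex k := fun k => by simp [hb]
  have hz : ∀ l k, b.repr (S.vertex i - w j) k ≠ 0 → S.vertex i - w j ∈ U l → k ≠ i ∧ k ≠ l := by
    intro l k hk hmem
    by_contra hn
    apply hk
    have hle : U l ≤ LinearMap.ker (b.coord k) := by
      rw [hU, Submodule.span_le]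
      rintro _ ⟨m, hm, rfl⟩
      have hmk : m ≠ k := fun h => hn (h ▸ hm)
      rw [SetLike.mem_coe, LinearMap.mem_ker, ← hbv, Module.Basis.coord_apply, Module.Basis.repr_self,
        Finsupp.single_eq_of_ne (Ne.symm hmk)]
    exact hle hmem
  have h0 : S.vertex i - w j = 0 := by
    rw [← b.repr.map_eq_zero_iff]
    ext k
    by_contra hk
    have hki := (hz j k hk (hsub j _)).1
    exact (hz k k hk (by rw [← hdiff k hki]; exact hsub k _)).2 rfl
  rw [sub_eq_zero.1 h0]
  exact hw1 j j (Ne.symm hij) (Ne.symm hij)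

end SphericalSimplex

namespace SphericalTriangulation

variable {ι P : Type*} [Fintype ι] [MetricSpace P] (τ : SphericalTriangulation ι P)

open Classical in
/-- The vertices of the triangulation. -/
noncomputable def vertexPoint (i : ι) : P :=
  τ.homeo ⟨Pi.single i 1, single_mem_stdSimplex ℝ i, {i}, τ.complex.singleton_mem i, fun j hj => by
    by_contra hn
    exact hj (Pi.single_eq_of_ne (by simpa using hn) _)⟩

open Classical in
/-- The spherical coordinates on an all-right spherical polyhedral space: the cosines of the
distances to the vertices of the simplices that contain the point. -/
noncomputable def coords (p : P) : EuclideanSpace ℝ ι :=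
  WithLp.toLp 2 fun i =>
    if ∃ s ∈ τ.complex, i ∈ s ∧ p ∈ τ.homeo '' τ.complex.closedSimplex s then
      Real.cos (dist p (τ.vertexPoint i)) else 0

lemma vertexPoint_mem {i : ι} {t : Finset ι} (hi : i ∈ t) :
    τ.vertexPoint i ∈ τ.homeo '' τ.complex.closedSimplex t := by
  classical
  refine ⟨_, fun j hj => ?_, rfl⟩
  by_contra hn
  have hji : j ≠ i := by rintro rfl; exact hn hi
  exact hj (Pi.single_eq_of_ne hji _)

lemma mem_image_iff {p : P} {s : Finset ι} : p ∈ τ.homeo '' τ.complex.closedSimplex s ↔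
    ∀ i, (τ.homeo.symm p).1 i ≠ 0 → i ∈ s := by
  constructor
  · rintro ⟨x, hx, rfl⟩
    rw [Homeomorph.symm_apply_apply]
    exact hx
  · intro h
    exact ⟨τ.homeo.symm p, h, τ.homeo.apply_symm_apply p⟩

open Classical in
/-- The carrier of a point: the smallest simplex that contains it. -/
noncomputable def carrier (p : P) : Finset ι :=
  Finset.univ.filter fun i => (τ.homeo.symm p).1 i ≠ 0

lemma mem_carrier {p : P} {i : ι} : i ∈ τ.carrier p ↔ (τ.homeo.symm p).1 i ≠ 0 := by
  simp [carrier]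

lemma mem_image_iff_carrier {p : P} {s : Finset ι} :
    p ∈ τ.homeo '' τ.complex.closedSimplex s ↔ τ.carrier p ⊆ s := by
  rw [mem_image_iff]
  exact ⟨fun h i hi => h i (τ.mem_carrier.1 hi), fun h i hi => h (τ.mem_carrier.2 hi)⟩

lemma carrier_mem (p : P) : τ.carrier p ∈ τ.complex := by
  obtain ⟨s, hs, h⟩ := (τ.homeo.symm p).2.2
  refine AbstractSimplicialComplex.mem_of_subset hs (fun i hi => h i (τ.mem_carrier.1 hi)) ?_
  by_contra hn
  rw [Finset.not_nonempty_iff_eq_empty] at hn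
  have hsum := (τ.homeo.symm p).2.1.2
  have h0 : ∀ i, (τ.homeo.symm p).1 i = 0 := by
    intro i
    by_contra hi
    have := τ.mem_carrier.2 hi
    rw [hn] at this
    exact absurd this (Finset.notMem_empty i)
  simp [h0] at hsum

variable {τ}

section simplex

variable {s : Finset ι} {S : SphericalSimplex s} {φ : P → EuclideanSpace ℝ s}

lemma norm_of_mem (hφ : IsSimplexIsometry τ.complex τ.homeo s S φ) {p : P}
    (hp : p ∈ τ.homeo '' τ.complex.closedSimplex s) : ‖φ p‖ = 1 := by
  have : φ p ∈ S.face {i | (i : ι) ∈ s} := by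
    rw [← hφ.image_face s subset_rfl]; exact ⟨p, hp, rfl⟩
  exact this.1

lemma exists_combination (hS : S.IsAllRight) (hφ : IsSimplexIsometry τ.complex τ.homeo s S φ)
    {t : Finset ι} (hts : t ⊆ s) {p : P} (hp : p ∈ τ.homeo '' τ.complex.closedSimplex t) :
    (∀ i, 0 ≤ inner ℝ (φ p) (S.vertex i)) ∧
      (∀ i : s, (i : ι) ∉ t → inner ℝ (φ p) (S.vertex i) = 0) ∧
      φ p = ∑ i, (inner ℝ (φ p) (S.vertex i) : ℝ) • S.vertex i := by
  classical
  have : φ p ∈ S.face {i | (i : ι) ∈ t} := by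
    rw [← hφ.image_face t hts]; exact ⟨p, hp, rfl⟩
  obtain ⟨-, c, hc, hct, e⟩ := this
  have hci : ∀ i, inner ℝ (φ p) (S.vertex i) = c i := by
    intro i
    rw [e, sum_inner]
    simp [real_inner_smul_left, orthonormal_iff_ite.1 hS.orthonormal]
  simp only [hci]
  exact ⟨hc, hct, e⟩

lemma map_vertexPoint (hS : S.IsAllRight) (hφ : IsSimplexIsometry τ.complex τ.homeo s S φ)
    (i : s) : φ (τ.vertexPoint i) = S.vertex i := by
  classical
  have hmem := τ.vertexPoint_mem (Finset.mem_singleton_self (i : ι))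
  have hsub : ({(i : ι)} : Finset ι) ⊆ s := by simp
  obtain ⟨h1, h2, h3⟩ := exists_combination hS hφ hsub hmem
  have hn := norm_of_mem hφ (τ.vertexPoint_mem i.2)
  rw [Finset.sum_eq_single i (fun j _ hj => by
    rw [h2 j (by simpa using fun h => hj (Subtype.ext h)), zero_smul]) (by simp)] at h3
  rw [h3, norm_smul, S.norm_vertex, mul_one, Real.norm_of_nonneg (h1 i)] at hn
  rw [h3, hn, one_smul]

lemma cos_dist_vertexPoint (hS : S.IsAllRight) (hφ : IsSimplexIsometry τ.complex τ.homeo s S φ)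
    (i : s) {p : P} (hp : p ∈ τ.homeo '' τ.complex.closedSimplex s) :
    Real.cos (dist p (τ.vertexPoint i)) = inner ℝ (φ p) (S.vertex i) := by
  rw [← hφ.dist_eq p hp _ (τ.vertexPoint_mem i.2), map_vertexPoint hS hφ, sphDist,
    inner_eq_cos_angle_of_norm_eq_one (norm_of_mem hφ hp) (S.norm_vertex i)]

end simplex

lemma coords_eq_inner {s : Finset ι} (hs : s ∈ τ.complex)
    {S : SphericalSimplex s} {φ : P → EuclideanSpace ℝ s} (hS : S.IsAllRight)
    (hφ : IsSimplexIsometry τ.complex τ.homeo s S φ) {p : P}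
    (hp : p ∈ τ.homeo '' τ.complex.closedSimplex s) (i : s) :
    τ.coords p i = inner ℝ (φ p) (S.vertex i) := by
  rw [← cos_dist_vertexPoint hS hφ i hp]
  exact if_pos ⟨s, hs, i.2, hp⟩

lemma coords_eq_zero (hτ : τ.IsAllRight) {i : ι} {p : P} (hi : i ∉ τ.carrier p) :
    τ.coords p i = 0 := by
  by_cases h : ∃ s ∈ τ.complex, i ∈ s ∧ p ∈ τ.homeo '' τ.complex.closedSimplex s
  · obtain ⟨s, hs, his, hp⟩ := h
    obtain ⟨S, φ, hS, hφ⟩ := hτ s hs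
    rw [coords_eq_inner hs hS hφ hp ⟨i, his⟩]
    exact (exists_combination hS hφ (τ.mem_image_iff_carrier.1 hp)
      (τ.mem_image_iff_carrier.2 subset_rfl)).2.1 ⟨i, his⟩ hi
  · exact if_neg h

/-- Parseval for the orthonormal vertices of one simplex; coordinates outside it vanish. -/
lemma inner_coords (hτ : τ.IsAllRight) {s : Finset ι} (hs : s ∈ τ.complex)
    {S : SphericalSimplex s} {φ : P → EuclideanSpace ℝ s} (hS : S.IsAllRight)
    (hφ : IsSimplexIsometry τ.complex τ.homeo s S φ) {p q : P}
    (hp : p ∈ τ.homeo '' τ.complex.closedSimplex s)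
    (hq : q ∈ τ.homeo '' τ.complex.closedSimplex s) :
    inner ℝ (τ.coords p) (τ.coords q) = inner ℝ (φ p) (φ q) := by
  classical
  have h1 : inner ℝ (τ.coords p) (τ.coords q) = ∑ i, τ.coords p i * τ.coords q i := by
    simp [PiLp.inner_apply, mul_comm]
  have h2 : ∑ i, τ.coords p i * τ.coords q i = ∑ i ∈ s, τ.coords p i * τ.coords q i := by
    symm
    refine Finset.sum_subset (Finset.subset_univ s) fun i _ hi => ?_
    rw [coords_eq_zero hτ fun h => hi (τ.mem_image_iff_carrier.1 hp h), zero_mul]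
  rw [h1, h2, ← Finset.sum_coe_sort]
  conv_rhs => rw [(exists_combination hS hφ subset_rfl hp).2.2, sum_inner]
  refine Finset.sum_congr rfl fun i _ => ?_
  rw [real_inner_smul_left, coords_eq_inner hs hS hφ hp,
    coords_eq_inner hs hS hφ hq, real_inner_comm (φ q) (S.vertex i)]

lemma norm_coords (hτ : τ.IsAllRight) (p : P) : ‖τ.coords p‖ = 1 := by
  obtain ⟨S, φ, hS, hφ⟩ := hτ _ (τ.carrier_mem p)
  have hp := τ.mem_image_iff_carrier.2 (subset_refl (τ.carrier p))
  have := inner_coords hτ (τ.carrier_mem p) hS hφ hp hp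
  rw [real_inner_self_eq_norm_sq, real_inner_self_eq_norm_sq, norm_of_mem hφ hp] at this
  exact pow_eq_one_iff_of_nonneg (norm_nonneg _) two_ne_zero |>.1 (by rw [this]; norm_num)

lemma coords_nonneg (hτ : τ.IsAllRight) (p : P) (i : ι) : 0 ≤ τ.coords p i := by
  by_cases hi : i ∈ τ.carrier p
  · obtain ⟨S, φ, hS, hφ⟩ := hτ _ (τ.carrier_mem p)
    have hp := τ.mem_image_iff_carrier.2 (subset_refl (τ.carrier p))
    rw [coords_eq_inner (τ.carrier_mem p) hS hφ hp ⟨i, hi⟩]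
    exact (exists_combination hS hφ subset_rfl hp).1 _
  · rw [coords_eq_zero hτ hi]

/-- If the coordinate at a vertex of the carrier vanished, φ p would lie in the opposite face. Since
φ is injective on the simplex, p would then lie in a proper face of its carrier. -/
lemma coords_ne_zero_iff (hτ : τ.IsAllRight) {p : P} {i : ι} :
    τ.coords p i ≠ 0 ↔ i ∈ τ.carrier p := by
  classical
  constructor
  · intro h
    by_contra hi
    exact h (coords_eq_zero hτ hi)
  · intro hi h0
    obtain ⟨S, φ, hS, hφ⟩ := hτ _ (τ.carrier_mem p)
    have hp := τ.mem_image_iff_carrier.2 (subset_refl (τ.carrier p))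
    rw [coords_eq_inner (τ.carrier_mem p) hS hφ hp ⟨i, hi⟩] at h0
    obtain ⟨h1, h2, h3⟩ := exists_combination hS hφ subset_rfl hp
    have hface : φ p ∈ S.face {j | (j : ι) ∈ (τ.carrier p).erase i} := by
      refine ⟨norm_of_mem hφ hp, _, h1, fun j hj => ?_, h3⟩
      have : j = ⟨i, hi⟩ := by
        by_contra hne
        exact hj (Finset.mem_erase.2 ⟨fun h => hne (Subtype.ext h), j.2⟩)
      rw [this, h0]
    rw [← hφ.image_face _ (Finset.erase_subset _ _)] at hface
    obtain ⟨q, hq, hqp⟩ := hface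
    have hq' := τ.mem_image_iff_carrier.2
      ((τ.mem_image_iff_carrier.1 hq).trans (Finset.erase_subset _ _))
    have hd := hφ.dist_eq p hp q hq'
    rw [hqp, sphDist, angle_self (norm_ne_zero_iff.1 (by rw [norm_of_mem hφ hp]; exact one_ne_zero))]
      at hd
    have hpq : p = q := dist_eq_zero.1 hd.symm
    rw [← hpq] at hq
    exact Finset.notMem_erase i _ (τ.mem_image_iff_carrier.1 hq hi)

/-- An all-right triangulation provides spherical coordinates. -/
theorem isSphericalCoords (hτ : τ.IsAllRight) : IsSphericalCoords τ.complex τ.coords where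
  norm_eq := norm_coords hτ
  nonneg := coords_nonneg hτ
  exists_simplex p := ⟨τ.carrier p, τ.carrier_mem p, fun i => coords_ne_zero_iff hτ⟩
  dist_eq p q s hs hp hq := by
    obtain ⟨S, φ, hS, hφ⟩ := hτ s hs
    have hp' := τ.mem_image_iff_carrier.2 fun i hi => hp i ((coords_ne_zero_iff hτ).2 hi)
    have hq' := τ.mem_image_iff_carrier.2 fun i hi => hq i ((coords_ne_zero_iff hτ).2 hi)
    rw [← hφ.dist_eq p hp' q hq', sphDist, angle, angle, inner_coords hτ hs hS hφ hp' hq',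
      norm_coords hτ, norm_coords hτ, norm_of_mem hφ hp', norm_of_mem hφ hq']
  surj u hu hu0 s hs hus := by
    classical
    obtain ⟨S, φ, hS, hφ⟩ := hτ s hs
    have horth := hS.orthonormal
    have hsum : ∑ i : s, u i ^ 2 = 1 := by
      rw [Finset.sum_coe_sort s fun i => u i ^ 2,
        Finset.sum_subset (Finset.subset_univ s) fun i _ hi => by
          rw [not_not.1 (mt (hus i) hi)]; norm_num]
      rw [← EuclideanSpace.real_norm_sq_eq, hu, one_pow]
    have hface : ∑ i : s, u i • S.vertex i ∈ S.face {i | (i : ι) ∈ s} := by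
      refine ⟨?_, fun i => u i, fun i => hu0 i, fun i hi => absurd i.2 hi, rfl⟩
      refine pow_eq_one_iff_of_nonneg (norm_nonneg _) two_ne_zero |>.1 ?_
      rw [← real_inner_self_eq_norm_sq, horth.inner_sum, ← hsum]
      exact Finset.sum_congr rfl fun i _ => by simp [sq]
    rw [← hφ.image_face s subset_rfl] at hface
    obtain ⟨p, hp, e⟩ := hface
    refine ⟨p, ?_⟩
    ext i
    by_cases hi : i ∈ s
    · rw [coords_eq_inner hs hS hφ hp ⟨i, hi⟩, e, sum_inner]
      simp [real_inner_smul_left, orthonormal_iff_ite.1 horth]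
    · rw [coords_eq_zero hτ fun h => hi (τ.mem_image_iff_carrier.1 hp h), not_not.1 (mt (hus i) hi)]
  eventually p := by
    refine Filter.eventually_all.2 fun i => ?_
    by_cases hi : τ.coords p i = 0
    · simp [hi]
    · have hc : Continuous fun q => (τ.homeo.symm q).1 i :=
        (continuous_apply i).comp (continuous_subtype_val.comp τ.homeo.symm.continuous)
      have hne := τ.mem_carrier.1 ((coords_ne_zero_iff hτ).1 hi)
      filter_upwards [hc.continuousAt.eventually_ne hne] with q hq _
      exact (coords_ne_zero_iff hτ).2 (τ.mem_carrier.2 hq)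

end SphericalTriangulation

/-! ### CAT(1) implies flag. -/

lemma angle_eq_of_inner_eq_cos {E : Type*} [NormedAddCommGroup E] [InnerProductSpace ℝ E] {u v : E}
    (hu : ‖u‖ = 1) (hv : ‖v‖ = 1) {θ : ℝ} (h0 : 0 ≤ θ) (hpi : θ ≤ Real.pi)
    (h : inner ℝ u v = Real.cos θ) : angle u v = θ := by
  rw [angle, hu, hv, mul_one, div_one, h, Real.arccos_cos h0 hpi]

/-- The midpoint of two orthogonal unit vectors on the sphere. -/
lemma sphere_midpoint {E : Type*} [NormedAddCommGroup E] [InnerProductSpace ℝ E] {u v : E}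
    (hu : ‖u‖ = 1) (hv : ‖v‖ = 1) (huv : inner ℝ u v = 0) :
    ‖(√2 / 2) • (u + v)‖ = 1 ∧ angle u ((√2 / 2) • (u + v)) = Real.pi / 4 ∧
      angle v ((√2 / 2) • (u + v)) = Real.pi / 4 := by
  have h2 : (√2) ^ 2 = 2 := Real.sq_sqrt (by norm_num)
  have hn : ‖(√2 / 2) • (u + v)‖ = 1 := by
    refine pow_eq_one_iff_of_nonneg (norm_nonneg _) two_ne_zero |>.1 ?_
    rw [norm_smul, mul_pow, norm_add_sq_real, huv, hu, hv, Real.norm_eq_abs, sq_abs, div_pow, h2]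
    norm_num
  have hpi := Real.pi_pos
  refine ⟨hn, angle_eq_of_inner_eq_cos hu hn (by linarith) (by linarith) ?_,
    angle_eq_of_inner_eq_cos hv hn (by linarith) (by linarith) ?_⟩
  · rw [Real.cos_pi_div_four, real_inner_smul_right, inner_add_right, huv,
      real_inner_self_eq_norm_sq, hu]; ring
  · rw [Real.cos_pi_div_four, real_inner_smul_right, inner_add_right, real_inner_comm, huv,
      real_inner_self_eq_norm_sq, hv]; ring

namespace IsSphericalCoords

variable {ι P : Type*} [Fintype ι] [MetricSpace P] {K : AbstractSimplicialComplex ι}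
  {Ψ : P → EuclideanSpace ℝ ι}

/-- The model of pxy is an octant, with p' the pole of the side x'y'. The model triangle of q is
degenerate: q' is the midpoint z' of that side, and comparison at z' gives π/2 + 0. -/
lemma dist_le_pi_div_two_of_isCAT1 (hC : IsCAT1 P) {p q x y : P}
    (hpx : dist p x = Real.pi / 2) (hpy : dist p y = Real.pi / 2) (hxy : dist x y = Real.pi / 2)
    (hqx : dist q x = Real.pi / 4) (hqy : dist q y = Real.pi / 4) : dist p q ≤ Real.pi / 2 := by
  have hpi := Real.pi_pos
  set x' : EuclideanSpace ℝ (Fin 3) := EuclideanSpace.single 0 1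
  set y' : EuclideanSpace ℝ (Fin 3) := EuclideanSpace.single 1 1
  set p' : EuclideanSpace ℝ (Fin 3) := EuclideanSpace.single 2 1
  have hx' : ‖x'‖ = 1 := by simp [x']
  have hy' : ‖y'‖ = 1 := by simp [y']
  have hp' : ‖p'‖ = 1 := by simp [p']
  have hxy' : inner ℝ x' y' = 0 := by simp [x', y', EuclideanSpace.inner_single_left]
  have hpx' : inner ℝ p' x' = 0 := by simp [p', x', EuclideanSpace.inner_single_left]
  have hpy' : inner ℝ p' y' = 0 := by simp [p', y', EuclideanSpace.inner_single_left]
  have hyp' : inner ℝ y' p' = 0 := by rw [real_inner_comm, hpy']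
  obtain ⟨hz', hxz', hyz'⟩ := sphere_midpoint hx' hy' hxy'
  set z' := (√2 / 2) • (x' + y')
  have a1 := inner_eq_zero_iff_angle_eq_pi_div_two _ _ |>.1 hxy'
  have a2 := inner_eq_zero_iff_angle_eq_pi_div_two _ _ |>.1 hpx'
  have a3 := inner_eq_zero_iff_angle_eq_pi_div_two _ _ |>.1 hyp'
  have hpz' : inner ℝ p' z' = 0 := by
    rw [real_inner_smul_right, inner_add_right, hpx', hpy']; simp
  have a4 := inner_eq_zero_iff_angle_eq_pi_div_two _ _ |>.1 hpz'
  have := hC p q x y (by rw [dist_comm y p]; linarith) (by rw [dist_comm y q]; linarith)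
    p' z' x' y'
    ⟨hp', hx', hy', a2.trans hpx.symm, a1.trans hxy.symm, a3.trans (by rw [dist_comm, hpy])⟩
    ⟨hz', hx', hy', by rw [sphDist, angle_comm, hxz', hqx], a1.trans hxy.symm,
      by rw [sphDist, hyz', dist_comm, hqy]⟩ z' hz'
    (by rw [sphDist, sphDist, sphDist, angle_comm z', hxz', hyz', a1]; ring)
  rw [sphDist, sphDist, a4, angle_self (norm_ne_zero_iff.1 (by rw [hz']; exact one_ne_zero))] at this
  linarith

/-- A point of the simplex opposite to the vertex `v` of a missing simplex is at distance more
than `π / 2` from `v`. -/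
lemma pi_div_two_lt_dist (h : IsSphericalCoords K Ψ) (hP : IsLengthSpace P) {p q : P} {v : ι}
    (hp : Ψ p v = 1) (hqv : Ψ q v = 0)
    (hK : ∀ s ∈ K, v ∈ s → ∃ i ∉ s, Ψ q i ≠ 0) : Real.pi / 2 < dist p q := by
  classical
  obtain ⟨r, hr, hball⟩ := Metric.eventually_nhds_iff.1 (h.eventually q)
  set e : EuclideanSpace ℝ ι := EuclideanSpace.single v 1 with he
  have hen : ‖e‖ = 1 := by simp [he]
  have hinner : ∀ x, inner ℝ e (Ψ x) = Ψ x v := by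
    intro x; simp [he, EuclideanSpace.inner_single_left]
  have hfar : ∀ x, ∀ s ∈ K, v ∈ s → (∀ i, Ψ x i ≠ 0 → i ∈ s) → max 0 (r - dist x q) = 0 := by
    intro x s hs hv hx
    refine max_eq_left ?_
    by_contra hlt
    push Not at hlt
    obtain ⟨i, his, hi⟩ := hK s hs hv
    exact his (hx i (hball (by linarith) i hi))
  -- On a simplex containing v the bump around q vanishes; on any other simplex the angle to e is
  -- constantly π/2. So f is 1-Lipschitz on each simplex, hence on P, while f p = 0 and f q = π/2 +
  -- r.
  set f : P → ℝ := fun x => angle e (Ψ x) + max 0 (r - dist x q) with hf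
  have hmain : ∀ x y, ∀ s ∈ K, (∀ i, Ψ x i ≠ 0 → i ∈ s) → (∀ i, Ψ y i ≠ 0 → i ∈ s) →
      f y - f x ≤ dist x y := by
    intro x y s hs hx hy
    by_cases hv : v ∈ s
    · have h1 := angle_le_angle_add_angle e (Ψ x) (Ψ y)
      rw [← h.dist_eq x y s hs hx hy] at h1
      simp only [hf, hfar x s hs hv hx, hfar y s hs hv hy]
      linarith
    · have h1 : angle e (Ψ x) = angle e (Ψ y) := by
        rw [angle, angle, hinner, hinner, h.norm_eq, h.norm_eq, not_not.1 (mt (hx v) hv),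
          not_not.1 (mt (hy v) hv)]
      have h2 : max 0 (r - dist y q) ≤ max 0 (r - dist x q) + dist x y := by
        refine max_le (add_nonneg (le_max_left _ _) dist_nonneg) ?_
        have := dist_triangle x y q
        linarith [le_max_right 0 (r - dist x q)]
      simp only [hf, h1]
      linarith
  have key := fun ε (hε : 0 < ε) => hP.rel_of_locally (fun x y l => f y - f x ≤ l)
    (fun x => by simp) (fun x y z l m h1 h2 => by linarith) (fun x y l m h1 h2 => h1.trans h2)
    (fun x => by
      filter_upwards [h.eventually_simplex x] with y hy
      obtain ⟨s, hs, hx, hy⟩ := hy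
      refine ⟨hmain x y s hs hx hy, ?_⟩
      rw [dist_comm]
      exact hmain y x s hs hy hx) p q hε
  have hle : f q - f p ≤ dist p q := le_of_forall_pos_le_add key
  have hfq : f q = Real.pi / 2 + r := by
    simp only [hf, dist_self, sub_zero, max_eq_right hr.le]
    rw [inner_eq_zero_iff_angle_eq_pi_div_two _ _ |>.1 (by rw [hinner, hqv])]
  have hfp : f p = 0 := by
    obtain ⟨s, hs, hps⟩ := h.exists_simplex p
    simp only [hf, hfar p s hs ((hps v).1 (by rw [hp]; exact one_ne_zero)) fun i => (hps i).1]
    rw [angle_eq_of_inner_eq_cos hen (h.norm_eq p) le_rfl Real.pi_pos.le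
      (by rw [hinner, hp, Real.cos_zero]), add_zero]
  linarith

open Classical in
/-- The unit vector in the middle of the face of the standard orthant spanned by `s`. -/
noncomputable def barycenterVector (s : Finset ι) : EuclideanSpace ℝ ι :=
  WithLp.toLp 2 fun i => if i ∈ s then (√s.card)⁻¹ else 0

open Classical in
omit [Fintype ι] in
lemma barycenterVector_apply (s : Finset ι) (i : ι) :
    barycenterVector s i = if i ∈ s then (√s.card)⁻¹ else 0 := rfl

lemma norm_barycenterVector {s : Finset ι} (hs : s.Nonempty) : ‖barycenterVector s‖ = 1 := by
  refine pow_eq_one_iff_of_nonneg (norm_nonneg _) two_ne_zero |>.1 ?_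
  have hc : (s.card : ℝ) ≠ 0 := by exact_mod_cast hs.card_pos.ne'
  rw [EuclideanSpace.real_norm_sq_eq]
  simp only [barycenterVector_apply, ite_pow]
  simp [Finset.sum_ite_mem, inv_pow, hc]

omit [Fintype ι] in
lemma barycenterVector_nonneg (s : Finset ι) (i : ι) : 0 ≤ barycenterVector s i := by
  rw [barycenterVector_apply]; split_ifs <;> positivity

omit [Fintype ι] in
lemma barycenterVector_ne_zero_iff {s : Finset ι} {i : ι} : barycenterVector s i ≠ 0 ↔ i ∈ s := by
  rw [barycenterVector_apply]
  split_ifs with h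
  · have : (0 : ℝ) < s.card := by exact_mod_cast Finset.card_pos.2 ⟨i, h⟩
    simp [h, (Real.sqrt_pos.2 this).ne']
  · simp [h]

lemma inner_eq_zero_of_disjoint {u v : EuclideanSpace ℝ ι} (h : ∀ i, u i = 0 ∨ v i = 0) :
    inner ℝ u v = 0 := by
  rw [PiLp.inner_apply]
  refine Finset.sum_eq_zero fun i _ => ?_
  rcases h i with h | h <;> simp [h]

lemma exists_barycenter (h : IsSphericalCoords K Ψ) {s : Finset ι} (hs : s ∈ K) :
    ∃ p, Ψ p = barycenterVector s :=
  h.surj _ (norm_barycenterVector (K.isRelLowerSet_faces hs).1) (barycenterVector_nonneg s) s hs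
    fun _ => barycenterVector_ne_zero_iff.1

lemma dist_barycenter (h : IsSphericalCoords K Ψ) {s t u : Finset ι} (hst : Disjoint s t)
    (hu : u ∈ K) (hsu : s ⊆ u) (htu : t ⊆ u) {p q : P} (hp : Ψ p = barycenterVector s)
    (hq : Ψ q = barycenterVector t) : inner ℝ (Ψ p) (Ψ q) = 0 ∧ dist p q = Real.pi / 2 := by
  have h0 : inner ℝ (Ψ p) (Ψ q) = 0 := by
    rw [hp, hq]
    refine inner_eq_zero_of_disjoint fun i => ?_
    by_contra hn
    push Not at hn
    exact Finset.disjoint_left.1 hst (barycenterVector_ne_zero_iff.1 hn.1)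
      (barycenterVector_ne_zero_iff.1 hn.2)
  refine ⟨h0, ?_⟩
  rw [h.dist_eq p q u hu (fun i hi => hsu (barycenterVector_ne_zero_iff.1 (hp ▸ hi)))
    (fun i hi => htu (barycenterVector_ne_zero_iff.1 (hq ▸ hi)))]
  exact inner_eq_zero_iff_angle_eq_pi_div_two _ _ |>.1 h0

theorem isFlag (h : IsSphericalCoords K Ψ) (hP : IsLengthSpace P) (hC : IsCAT1 P) : K.IsFlag := by
  classical
  intro s
  induction s using Finset.strongInduction with
  | H s ih =>
    intro hs hpair
    have hsub : ∀ t, t ⊂ s → t.Nonempty → t ∈ K := fun t ht htn =>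
      ih t ht htn fun v hv w hw hvw => hpair v (ht.1 hv) w (ht.1 hw) hvw
    obtain ⟨v, hv⟩ := hs
    rcases (s.erase v).eq_empty_or_nonempty with hE | ⟨w, hw⟩
    · have : s = {v} := by rw [← Finset.insert_erase hv, hE]; rfl
      rw [this]
      exact K.singleton_mem v
    have hwv : w ≠ v := Finset.ne_of_mem_erase hw
    have hws : w ∈ s := Finset.mem_of_mem_erase hw
    have hvw : v ≠ w := hwv.symm
    rcases ((s.erase v).erase w).eq_empty_or_nonempty with hE | hne
    · have : s = {v, w} := by
        rw [← Finset.insert_erase hv, ← Finset.insert_erase hw, hE]; rfl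
      have hm := hpair v hv w hws hvw
      rw [this]
      convert hm
    -- Now s is a missing simplex with at least three vertices and all proper faces present. The
    -- points are p = v, x = w, y the barycenter of the remaining face F, and q the midpoint of x
    -- and y, whose support is all of s \ {v}.
    by_contra hsK
    set F := (s.erase v).erase w with hF
    have hFs : F ⊆ s := (Finset.erase_subset _ _).trans (Finset.erase_subset _ _)
    have hvF : v ∉ F := fun hm => Finset.notMem_erase v s (Finset.mem_of_mem_erase hm)
    have hwF : w ∉ F := Finset.notMem_erase w _
    have k1 : s.erase v ∈ K := hsub _ (Finset.erase_ssubset hv) ⟨w, hw⟩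
    have k2 : s.erase w ∈ K := hsub _ (Finset.erase_ssubset hws) ⟨v, Finset.mem_erase.2 ⟨hvw, hv⟩⟩
    have k3 : F ∈ K := AbstractSimplicialComplex.mem_of_subset k1 (Finset.erase_subset _ _) hne
    have k4 : ({v, w} : Finset ι) ∈ K := by convert hpair v hv w hws hvw
    obtain ⟨p, hp⟩ := h.exists_barycenter (K.singleton_mem v)
    obtain ⟨x, hx⟩ := h.exists_barycenter (K.singleton_mem w)
    obtain ⟨y, hy⟩ := h.exists_barycenter k3
    have dpx := (h.dist_barycenter (by simpa using hvw) k4 (by simp) (by simp) hp hx).2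
    have dpy := (h.dist_barycenter (Finset.disjoint_singleton_left.2 hvF) k2
      (by simpa using ⟨hvw, hv⟩) (fun i hi => Finset.mem_erase.2
        ⟨fun e => hwF (e ▸ hi), hFs hi⟩) hp hy).2
    obtain ⟨ixy, dxy⟩ := h.dist_barycenter (Finset.disjoint_singleton_left.2 hwF) k1
      (by simpa using ⟨hwv, hws⟩) (Finset.erase_subset _ _) hx hy
    obtain ⟨hn, hax, hay⟩ := sphere_midpoint (h.norm_eq x) (h.norm_eq y) ixy
    have hsupp : ∀ i, ((√2 / 2) • (Ψ x + Ψ y)) i ≠ 0 ↔ i ∈ s.erase v := by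
      intro i
      have h2 : (0 : ℝ) < √2 / 2 := by positivity
      have e : ((√2 / 2) • (Ψ x + Ψ y)) i = √2 / 2 * (Ψ x i + Ψ y i) := rfl
      rw [e, mul_ne_zero_iff, and_iff_right h2.ne', ne_eq,
        add_eq_zero_iff_of_nonneg (h.nonneg x i) (h.nonneg y i), not_and_or, hx, hy]
      rw [← ne_eq, ← ne_eq, barycenterVector_ne_zero_iff, barycenterVector_ne_zero_iff,
        ← Finset.insert_erase hw, Finset.mem_insert, Finset.mem_singleton]
    obtain ⟨q, hq⟩ := h.surj _ hn (fun i => mul_nonneg (by positivity)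
      (add_nonneg (h.nonneg x i) (h.nonneg y i))) _ k1 fun i => (hsupp i).1
    have sx : ∀ i, Ψ x i ≠ 0 → i ∈ s.erase v := fun i hi => by
      rw [hx] at hi
      rw [Finset.mem_singleton.1 (barycenterVector_ne_zero_iff.1 hi)]
      exact hw
    have sy : ∀ i, Ψ y i ≠ 0 → i ∈ s.erase v := fun i hi => by
      rw [hy] at hi
      exact Finset.mem_of_mem_erase (barycenterVector_ne_zero_iff.1 hi)
    have sq : ∀ i, Ψ q i ≠ 0 ↔ i ∈ s.erase v := by rw [hq]; exact hsupp
    have dqx : dist q x = Real.pi / 4 := by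
      rw [h.dist_eq q x _ k1 (fun i => (sq i).1) sx, hq, angle_comm, hax]
    have dqy : dist q y = Real.pi / 4 := by
      rw [h.dist_eq q y _ k1 (fun i => (sq i).1) sy, hq, angle_comm, hay]
    have hle := dist_le_pi_div_two_of_isCAT1 hC dpx dpy dxy dqx dqy
    refine absurd hle (not_le.2 (h.pi_div_two_lt_dist hP (v := v) ?_ ?_ ?_))
    · rw [hp, barycenterVector_apply]; simp
    · by_contra hqv
      exact Finset.notMem_erase v s ((sq v).1 hqv)
    · intro t ht hvt
      by_contra hcon
      push Not at hcon
      refine hsK (AbstractSimplicialComplex.mem_of_subset ht (fun i hi => ?_) ⟨v, hv⟩)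
      by_cases hiv : i = v
      · rw [hiv]; exact hvt
      · by_contra hit
        exact (sq i).2 (Finset.mem_erase.2 ⟨hiv, hi⟩) (hcon i hit)

end IsSphericalCoords

theorem mainTheorem7 {P : Type*} [MetricSpace P] (hP : IsSphericalPolyhedralSpace P)
    {ι : Type*} [Fintype ι] (τ : SphericalTriangulation ι P) (hτ : τ.IsAllRight) :
    IsCAT1 P ↔ τ.complex.IsFlag := by
  have h := SphericalTriangulation.isSphericalCoords hτ
  exact ⟨h.isFlag hP.1, fun hK => h.isCAT1 hK hP.1⟩
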